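/- Let $n\ge 1$, $\Gamma_1=\{y\in\mathbb R^n: y_1>0,\dots,y_n>0\}$ and $T_{\Gamma_1}=\{x+iy: x\in\mathbb R^n,\ y\in\Gamma_1\}\subset\mathbb C^n$. Let $H^2(T_{\Gamma_1})$ be the space of holomorphic $F$ on $T_{\Gamma_1}$ with $\|F\|^2=\sup_{y\in\Gamma_1}\int_{\mathbb R^n}|F(x+iy)|^2dx<\infty$, with inner product $\langle F,G\rangle=\int_{\mathbb R^n}F(\xi)\overline{G(\xi)}\,d\xi$, where $F(\xi)$, $G(\xi)$ are the $L^2$-limits of $F(\xi+i\eta)$, $G(\xi+i\eta)$ as $\eta\to0$, $\eta\in\Gamma_1$. Let $K(w,\overline z)=\prod_{k=1}^n\frac{-1}{2\pi i(w_k-\overline{z_k})}$ be the Cauchy–Szegő kernel. Let $\mathcal A_0$ consist of the family $z\mapsto K(\cdot,\overline z)$, and let $\mathcal A_{h+1}$ consist of all directional derivatives, with respect to the parameter $z\in\mathbb C^n=\mathbb R^{2n}$ and in any real direction, of the families in $\mathcal A_h$. To finite sequences of points of $T_{\Gamma_1}$ attach kernel elements by a rule of the following kind: given $z^{(1)},\dots,z^{(k)}$,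 if $l_k$ is the number of $j\le k$ with $z^{(j)}=z^{(k)}$, and $h_k\ge0$ is the integer with $\binom{h_k-1+n}{n}<l_k\le\binom{h_k+n}{n}$, then $\Phi_{z^{(k)}}$ (which may depend on $z^{(1)},\dots,z^{(k)}$) is the value at the parameter $z=z^{(k)}$ of a family in $\mathcal A_{h_k}$ (so $\Phi_{z^{(k)}}=K(\cdot,\overline{z^{(k)}})$ if $z^{(k)}$ has not occurred before); and the elements attached to the repetitions of one and the same point are linearly independent. For given points put $A_m=(\langle\Phi_{z^{(k)}},\Phi_{z^{(j)}}\rangle)_{j,k=1}^m$ and $$F^*_{A_m}=\sum_{j=1}^m\sum_{k=1}^m\langle F,\Phi_{z^{(j)}}\rangle\,\widetilde{a^{(m)}_{j,k}}\,\Phi_{z^{(k)}},$$ where $\widetilde{a^{(m)}_{j,k}}$ are the entries of $\overline{A_m^{-1}}$. **Theorem.** Let $F\in H^2(T_{\Gamma_1})$, fix such a rule, and let $\{z^{(k)}\}_{k=1}^\infty\subset T_{\Gamma_1}$ be a sequence, not necessarily of distinct points, such that for every $m\ge0$, given $z^{(1)},\dots,z^{(m)}$, the point $z^{(m+1)}$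 minimises $\|F-F^*_{A_{m+1}}\|^2$ over all choices of the $(m+1)$-st point in $T_{\Gamma_1}$. Then every $A_m$ is invertible, every $F^*_{A_m}$ belongs to $H^2(T_{\Gamma_1})$, and $$\lim_{m\to\infty}\|F-F^*_{A_m}\|=0.$$ -/

import Mathlib

open MeasureTheory Filter Topology
open scoped ENNReal ComplexConjugate

noncomputable section

/-- The first octant `{y ∈ ℝⁿ : y₁ > 0, …, yₙ > 0}`. -/
def octant (n : ℕ) : Set (Fin n → ℝ) := {y | ∀ k, 0 < y k}

/-- The tube `{x + iy : x ∈ ℝⁿ, y ∈ octant}` in `ℂⁿ`. -/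
def tube (n : ℕ) : Set (Fin n → ℂ) := {z | (fun k => (z k).im) ∈ octant n}

/-- The point `x + iy` of `ℂⁿ`. -/
def tubePoint {n : ℕ} (x y : Fin n → ℝ) : Fin n → ℂ :=
  fun k => (x k : ℂ) + (y k : ℂ) * Complex.I

/-- `‖F‖² = sup_{y ∈ octant} ∫_{ℝⁿ} |F(x + iy)|² dx`, as an element of `[0, ∞]`. -/
def hardyNormSq {n : ℕ} (F : (Fin n → ℂ) → ℂ) : ℝ≥0∞ :=
  ⨆ y ∈ octant n, ∫⁻ x : Fin n → ℝ, ‖F (tubePoint x y)‖ₑ ^ 2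

/-- The norm of the Hardy space, as an element of `[0, ∞]`. -/
def hardyNorm {n : ℕ} (F : (Fin n → ℂ) → ℂ) : ℝ≥0∞ := hardyNormSq F ^ (1 / 2 : ℝ)

/-- Membership in the Hardy space `H²` of the tube. Only the values of `F` on the tube matter. -/
def MemHardy {n : ℕ} (F : (Fin n → ℂ) → ℂ) : Prop :=
  DifferentiableOn ℂ F (tube n) ∧ hardyNormSq F < ∞

/-- `f` is the limit function of `F`: `f ∈ L²(ℝⁿ)` and `F(· + iη) → f` in `L²` as `η → 0`
inside the octant. Such an `f` is unique up to almost everywhere equality. -/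
def IsLimitFunction {n : ℕ} (F : (Fin n → ℂ) → ℂ) (f : (Fin n → ℝ) → ℂ) : Prop :=
  MemLp f 2 volume ∧
    Tendsto (fun η : Fin n → ℝ => eLpNorm (fun ξ => F (tubePoint ξ η) - f ξ) 2 volume)
      (𝓝[octant n] 0) (𝓝 0)

open Classical in
/-- A representative of the limit function of `F` on `ℝⁿ` (and `0` if `F` has none). -/
def limitFunction {n : ℕ} (F : (Fin n → ℂ) → ℂ) : (Fin n → ℝ) → ℂ :=
  if h : ∃ f, IsLimitFunction F f then h.choose else 0

/-- The inner product `⟨F, G⟩ = ∫_{ℝⁿ} F(ξ) conj(G(ξ)) dξ` of the Hardy space, where `F(ξ)` and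
`G(ξ)` are the limit functions. -/
def hardyInner {n : ℕ} (F G : (Fin n → ℂ) → ℂ) : ℂ :=
  ∫ ξ : Fin n → ℝ, limitFunction F ξ * conj (limitFunction G ξ)

/-- The Cauchy–Szegő kernel `K(w, conj z) = ∏ₖ -1 / (2πi (wₖ - conj zₖ))`. -/
def szegoKernel {n : ℕ} (w z : Fin n → ℂ) : ℂ :=
  ∏ k, (-1) / (2 * (Real.pi : ℂ) * Complex.I * (w k - conj (z k)))

/-- The classes of iterated directional derivatives of the Cauchy–Szegő kernel with respect to
its parameter: the only member of order `0` is `z ↦ K(·, conj z)`, and the members of order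
`h + 1` are the derivatives, with respect to the parameter `z ∈ ℂⁿ = ℝ²ⁿ` and in any real
direction `l ∈ ℂⁿ = ℝ²ⁿ`, of the members of order `h`. A member is written as a function
`Ψ` with `Ψ z w` its value at `w` for the parameter `z`. -/
def kernelDerivatives (n : ℕ) : ℕ → Set ((Fin n → ℂ) → (Fin n → ℂ) → ℂ)
  | 0 => {fun z w => szegoKernel w z}
  | h + 1 => {Ψ | ∃ Ψ' ∈ kernelDerivatives n h, ∃ l : Fin n → ℂ,
      Ψ = fun z w => lineDeriv ℝ (fun ζ => Ψ' ζ w) z l}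

open Classical in
/-- The number of indices `j ≤ k` with `p j = p k`. -/
def occurrences {n : ℕ} (p : ℕ → Fin n → ℂ) (k : ℕ) : ℕ :=
  ((Finset.range (k + 1)).filter (fun j => p j = p k)).card

/-- A choice of kernel elements for sequences of points: to the sequence `p` of points of the
tube and the index `k` it assigns the element `Φ p k` attached to the point `p k`. -/
structure IsKernelChoice {n : ℕ}
    (Φ : (ℕ → Fin n → ℂ) → ℕ → (Fin n → ℂ) → ℂ) : Prop where
  /-- The element attached to `p k` depends only on `p 0, …, p k`. -/
  causal : ∀ (p q : ℕ → Fin n → ℂ) (k : ℕ), (∀ j ≤ k, p j = q j) → Φ p k = Φ q k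
  /-- If `p k` occurs for the `l`-th time at the index `k`, then `Φ p k` is a derivative at `p k`
  of order `h`, where `binom (h - 1 + n) n < l ≤ binom (h + n) n`. -/
  order : ∀ p : ℕ → Fin n → ℂ, (∀ j, p j ∈ tube n) → ∀ k, ∃ h : ℕ,
    (h + n - 1).choose n < occurrences p k ∧ occurrences p k ≤ (h + n).choose n ∧
      ∃ Ψ ∈ kernelDerivatives n h, Φ p k = Ψ (p k)
  /-- The elements attached to repetitions of one point are linearly independent on the tube. -/
  indep : ∀ p : ℕ → Fin n → ℂ, (∀ j, p j ∈ tube n) → ∀ k,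
    LinearIndependent ℂ
      (fun j : {j : ℕ // j ≤ k ∧ p j = p k} => (tube n).domRestrict (Φ p j))

/-- The matrix `A_m` with entries `a_{j,k} = ⟨Φₖ, Φⱼ⟩`, `j, k < m`. -/
def gramMatrix {n : ℕ} (Φ : ℕ → (Fin n → ℂ) → ℂ) (m : ℕ) : Matrix (Fin m) (Fin m) ℂ :=
  Matrix.of fun j k => hardyInner (Φ k) (Φ j)

/-- `F*_{A_m} = ∑ⱼ ∑ₖ ⟨F, Φⱼ⟩ ã_{j,k} Φₖ`, where `ã_{j,k}` are the entries of the entrywise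
complex conjugate of `A_m⁻¹`. -/
def afdApprox {n : ℕ} (F : (Fin n → ℂ) → ℂ) (Φ : ℕ → (Fin n → ℂ) → ℂ) (m : ℕ) :
    (Fin n → ℂ) → ℂ := fun w =>
  ∑ j : Fin m, ∑ k : Fin m,
    hardyInner F (Φ j) * conj ((gramMatrix Φ m)⁻¹ j k) * Φ k w

/-- The minimal selection principle: for every `m`, given the first `m` points, the next point
`z m` minimises `‖F - F*_{A_{m+1}}‖²` among all points of the tube. -/
def IsGreedy {n : ℕ} (F : (Fin n → ℂ) → ℂ)
    (Φ : (ℕ → Fin n → ℂ) → ℕ → (Fin n → ℂ) → ℂ) (z : ℕ → Fin n → ℂ) : Prop :=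
  ∀ m : ℕ, z m ∈ tube n ∧ ∀ w ∈ tube n,
    hardyNormSq (F - afdApprox F (Φ z) (m + 1)) ≤
      hardyNormSq (F - afdApprox F (Φ (Function.update z m w)) (m + 1))

end

/-! Taking boundary values embeds $H^2$, modulo values off the tube, isometrically into $L^2(\mathbb
R^n)$, and there $K$ is a reproducing kernel. Kernel elements attached to a sequence of points are
linearly independent, so each Gram matrix is invertible and $F^*_{A_m}$ is the orthogonal projection
of $F$ onto the span of the first $m$ elements.

Let $r_m=F-F^*_{A_m}$. The spans are nested, so $\|r_m\|^2$ decreases to some $L$ and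
$\|r_m-r_k\|^2=\|r_m\|^2-\|r_k\|^2$ for $m\le k$. If $w$ is not in the sequence, choosing $w$ as the
next point would add $K_w=K(\cdot,\overline w)$ to the span; minimality then gives
$\|r_{m+1}\|^2\le\|r_m-cK_w\|^2$ for all $c$. The best $c$ yields
$|r_m(w)|^2\le\|K_w\|^2(\|r_m\|^2-\|r_{m+1}\|^2)\to0$ (`norm_residual_sq_le`). Thus $r_k\to0$
pointwise off a countable set, which is null on every slice, and Fatou gives
$\|r_m\|^2\le\liminf_k\|r_m-r_k\|^2\le\|r_m\|^2-L\to0$ (`hardyNormSq_le_of_tendsto`).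

Three facts carry this. Boundary values exist because the $L^2$ pairing of two slices depends only
on the sum of their heights (`integral_slice_mul_conj_slice_shift`). The reproducing property is the
Cauchy formula, proved in the half-plane and extended by induction on $n$ (`cauchy_formula_tube`).
Independence is uniqueness of partial fractions (`linearIndependent_inv_pow`) together with the
hypothesis at each single point. -/

/-! ### Parameter integrals and the area mean value inequality -/

/-- An integral of functions that depend holomorphically on a parameter is holomorphic in the
parameter, if the `L¹` norms are bounded. -/
theorem differentiableOn_integral_of_lintegral_le {X : Type*} [TopologicalSpace X]
    [MeasurableSpace X] [OpensMeasurableSpace X] [SecondCountableTopology X] (μ : Measure X)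
    [SFinite μ] {U : Set ℂ} (hU : IsOpen U) {H : ℂ → X → ℂ}
    (hc : ContinuousOn (Function.uncurry H) (U ×ˢ Set.univ))
    (hd : ∀ x, DifferentiableOn ℂ (fun ζ => H ζ x) U) {M : ℝ≥0∞} (hM : M ≠ ∞)
    (hb : ∀ ζ ∈ U, ∫⁻ x, ‖H ζ x‖ₑ ∂μ ≤ M) :
    DifferentiableOn ℂ (fun ζ => ∫ x, H ζ x ∂μ) U := by
  intro c hcU
  obtain ⟨R, hR, hRU⟩ := Metric.nhds_basis_closedBall.mem_iff.1 (hU.mem_nhds hcU)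
  have hmem : ∀ θ, circleMap c R θ ∈ U := fun θ => hRU (circleMap_mem_closedBall c hR.le θ)
  set ν : Measure ℝ := volume.restrict (Set.Ioc 0 (2 * Real.pi)) with hν
  have hcont : Continuous (fun p : ℝ × X => H (circleMap c R p.1) p.2) := by
    have := hc.comp_continuous (f := fun p : ℝ × X => (circleMap c R p.1, p.2))
      (by fun_prop) (fun p => ⟨hmem p.1, trivial⟩)
    exact this
  -- The bound on each $L^1$ norm and the finite length of the circle give integrability on circle ×
  -- `X`, so Fubini applies.
  have hint : Integrable (fun p : ℝ × X => H (circleMap c R p.1) p.2) (ν.prod μ) := by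
    refine ⟨hcont.aestronglyMeasurable, ?_⟩
    rw [hasFiniteIntegral_iff_enorm, lintegral_prod _ hcont.measurable.enorm.aemeasurable]
    calc ∫⁻ θ, ∫⁻ x, ‖H (circleMap c R θ) x‖ₑ ∂μ ∂ν ≤ ∫⁻ _, M ∂ν :=
          lintegral_mono fun θ => hb _ (hmem θ)
      _ < ∞ := by
          rw [lintegral_const]
          exact ENNReal.mul_lt_top hM.lt_top (measure_lt_top _ _)
  have hJ : CircleIntegrable (fun ζ => ∫ x, H ζ x ∂μ) c R := by
    rw [CircleIntegrable, intervalIntegrable_iff_integrableOn_Ioc_of_le (by positivity)]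
    exact hint.integral_prod_left
  have hR' : (0 : NNReal) < ⟨R, hR.le⟩ := hR
  have hps := hasFPowerSeriesOn_cauchy_integral (R := ⟨R, hR.le⟩) hJ hR'
  have hdiff := hps.differentiableOn.differentiableAt
    (IsOpen.mem_nhds Metric.isOpen_eball (Metric.mem_eball_self (ENNReal.coe_pos.2 hR')))
  -- The Cauchy formula for each `x`, followed by Fubini, identifies the integral near `c` with the
  -- Cauchy transform of its values on the circle, which is analytic.
  refine (hdiff.congr_of_eventuallyEq ?_).differentiableWithinAt
  filter_upwards [Metric.ball_mem_nhds c hR] with w hw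
  have hk : Continuous fun θ : ℝ => deriv (circleMap c R) θ * (circleMap c R θ - w)⁻¹ := by
    have h2 : ∀ θ, circleMap c R θ - w ≠ 0 := fun θ h0 => by
      have h1 : circleMap c R θ ∈ Metric.sphere c R := circleMap_mem_sphere c hR.le θ
      rw [sub_eq_zero.1 h0] at h1
      exact (Metric.mem_ball.1 hw).ne (Metric.mem_sphere.1 h1)
    simp only [deriv_circleMap]
    exact ((by fun_prop : Continuous fun θ : ℝ => circleMap 0 R θ * Complex.I)).mul
      (Continuous.inv₀ (by fun_prop) h2)
  obtain ⟨C, hC⟩ := (isCompact_Icc (a := (0 : ℝ)) (b := 2 * Real.pi)).exists_bound_of_continuousOn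
    hk.continuousOn
  have hint2 : Integrable (fun p : ℝ × X =>
      (deriv (circleMap c R) p.1 * (circleMap c R p.1 - w)⁻¹) * H (circleMap c R p.1) p.2)
      (ν.prod μ) := by
    refine hint.bdd_mul (c := C) (hk.comp continuous_fst).aestronglyMeasurable ?_
    have : ∀ᵐ θ ∂ν, ‖deriv (circleMap c R) θ * (circleMap c R θ - w)⁻¹‖ ≤ C := by
      rw [hν, ae_restrict_iff' measurableSet_Ioc]
      exact Eventually.of_forall fun θ hθ => hC θ (Set.Ioc_subset_Icc_self hθ)
    exact Measure.quasiMeasurePreserving_fst.ae this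
  calc ∫ x, H w x ∂μ
      = ∫ x, (2 * Real.pi * Complex.I : ℂ)⁻¹ • ∮ z in C(c, R), (z - w)⁻¹ • H z x ∂μ := by
        refine integral_congr_ae (Eventually.of_forall fun x => ?_)
        exact (Complex.two_pi_I_inv_smul_circleIntegral_sub_inv_smul_of_differentiable_on_off_countable
          Set.countable_empty hw ((hd x).continuousOn.mono hRU) fun z hz =>
            (hd x).differentiableAt (hU.mem_nhds (hRU (Metric.ball_subset_closedBall hz.1)))).symm
    _ = (2 * Real.pi * Complex.I : ℂ)⁻¹ • ∮ z in C(c, R), (z - w)⁻¹ • ∫ x, H z x ∂μ := by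
        rw [integral_smul]
        congr 1
        simp only [circleIntegral, smul_eq_mul, ← mul_assoc]
        rw [intervalIntegral.integral_of_le (by positivity), ← hν]
        simp_rw [intervalIntegral.integral_of_le (show (0 : ℝ) ≤ 2 * Real.pi by positivity), ← hν]
        rw [← integral_integral_swap hint2]
        simp_rw [integral_const_mul]

/-- If the integral of `H ζ` is holomorphic in `ζ` and invariant under real translations of `ζ`,
then it is constant. -/
theorem integral_eq_of_translation_invariant {X : Type*} [TopologicalSpace X]
    [MeasurableSpace X] [OpensMeasurableSpace X] [SecondCountableTopology X] (μ : Measure X)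
    [SFinite μ] {U : Set ℂ} (hU : IsOpen U) (hconv : Convex ℝ U) {H : ℂ → X → ℂ}
    (hc : ContinuousOn (Function.uncurry H) (U ×ˢ Set.univ))
    (hd : ∀ x, DifferentiableOn ℂ (fun ζ => H ζ x) U) {M : ℝ≥0∞} (hM : M ≠ ∞)
    (hb : ∀ ζ ∈ U, ∫⁻ x, ‖H ζ x‖ₑ ∂μ ≤ M)
    (ht : ∀ ζ ∈ U, ∀ t : ℝ, ∫ x, H (ζ + t) x ∂μ = ∫ x, H ζ x ∂μ)
    {ζ ζ' : ℂ} (hζ : ζ ∈ U) (hζ' : ζ' ∈ U) : ∫ x, H ζ x ∂μ = ∫ x, H ζ' x ∂μ := by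
  have hJ := differentiableOn_integral_of_lintegral_le μ hU hc hd hM hb
  have hder : U.EqOn (deriv fun ζ => ∫ x, H ζ x ∂μ) 0 := by
    intro w hw
    have h1 := (hJ.differentiableAt (hU.mem_nhds hw)).hasDerivAt
    have h2 : HasDerivAt (fun t : ℝ => w + (t : ℂ)) 1 0 := by
      simpa using (Complex.ofRealCLM.hasDerivAt (x := (0 : ℝ))).const_add w
    -- The complex derivative can be computed along the real direction, where the integral is
    -- constant.
    have h3 := HasDerivAt.scomp (x := (0 : ℝ)) (h := fun t : ℝ => w + (t : ℂ))
      (g₁ := fun ζ => ∫ x, H ζ x ∂μ) (g₁' := deriv (fun ζ => ∫ x, H ζ x ∂μ) w) (h' := 1)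
      (by simpa using h1) h2
    have h4 : ((fun ζ => ∫ x, H ζ x ∂μ) ∘ fun t : ℝ => w + (t : ℂ)) = fun _ => ∫ x, H w x ∂μ :=
      funext fun t => ht w hw t
    rw [h4] at h3
    simpa using h3.unique (hasDerivAt_const (0 : ℝ) _)
  exact hU.is_const_of_deriv_eq_zero hconv.isPreconnected hJ hder hζ hζ'

/-- The area mean value inequality for the square of a holomorphic function. -/
theorem enorm_sq_le_lintegral_ball {g : ℂ → ℂ} {c : ℂ} {r : ℝ} (hr : 0 < r)
    (hg : DifferentiableOn ℂ g (Metric.ball c r)) :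
    ENNReal.ofReal (Real.pi * r ^ 2) * ‖g c‖ₑ ^ 2 ≤ ∫⁻ z in Metric.ball c r, ‖g z‖ₑ ^ 2 := by
  have hpi := Real.pi_pos
  -- Mean value property of $g^2$ on each circle; integrating against $\rho\,d\rho$ gives the area
  -- inequality.
  have key : ∀ ρ ∈ Set.Ioo 0 r, ENNReal.ofReal (2 * Real.pi) * ‖g c‖ₑ ^ 2 ≤
      ∫⁻ θ in Set.Ioo (-Real.pi) Real.pi, ‖g (circleMap c ρ θ)‖ₑ ^ 2 := by
    intro ρ hρ
    have hsub : Metric.closedBall c ρ ⊆ Metric.ball c r := Metric.closedBall_subset_ball hρ.2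
    have h1 : Real.circleAverage (fun z => g z ^ 2) c ρ = g c ^ 2 :=
      circleAverage_of_differentiable_on_off_countable Set.countable_empty
        (by rw [abs_of_pos hρ.1]; exact (hg.continuousOn.mono hsub).pow 2)
        (fun z hz => by
          rw [abs_of_pos hρ.1] at hz
          exact ((hg.differentiableAt (Metric.isOpen_ball.mem_nhds
            (hsub (Metric.ball_subset_closedBall hz.1))))).pow 2)
    rw [Real.circleAverage_eq_integral_add (-Real.pi)] at h1
    have h2 : ‖(2 * Real.pi) • (g c ^ 2)‖ₑ = ENNReal.ofReal (2 * Real.pi) * ‖g c‖ₑ ^ 2 := by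
      rw [enorm_smul, enorm_pow, Real.enorm_of_nonneg (by positivity)]
    rw [← h2, ← h1, smul_inv_smul₀ (by positivity),
      intervalIntegral.integral_comp_add_right (fun θ => g (circleMap c ρ θ) ^ 2),
      intervalIntegral.integral_of_le (by linarith)]
    have e1 : 0 + -Real.pi = -Real.pi := by ring
    have e2 : 2 * Real.pi + -Real.pi = Real.pi := by ring
    rw [e1, e2, restrict_Ioo_eq_restrict_Ioc]
    exact (enorm_integral_le_lintegral_enorm _).trans_eq (by simp only [enorm_pow])
  have hm : MeasurableSet (Metric.ball c r) := measurableSet_ball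
  rw [← lintegral_indicator hm, ← lintegral_add_left_eq_self _ c,
    ← Complex.lintegral_comp_polarCoord_symm]
  have htar : (Set.Ioo 0 r ×ˢ Set.Ioo (-Real.pi) Real.pi : Set (ℝ × ℝ)) ⊆ polarCoord.target := by
    rintro ⟨ρ, θ⟩ ⟨h1, h2⟩
    exact ⟨h1.1, h2⟩
  have hval : ∀ p ∈ (Set.Ioo 0 r ×ˢ Set.Ioo (-Real.pi) Real.pi : Set (ℝ × ℝ)),
      (Metric.ball c r).indicator (fun z => ‖g z‖ₑ ^ 2) (c + Complex.polarCoord.symm p) =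
        ‖g (circleMap c p.1 p.2)‖ₑ ^ 2 := by
    rintro ⟨ρ, θ⟩ ⟨h1, h2⟩
    have e : c + Complex.polarCoord.symm (ρ, θ) = circleMap c ρ θ := by
      rw [Complex.polarCoord_symm_apply, circleMap, Complex.exp_mul_I]
      simp
    rw [e, Set.indicator_of_mem]
    exact Metric.closedBall_subset_ball h1.2 (circleMap_mem_closedBall c h1.1.le θ)
  have hcont : ContinuousOn (fun p : ℝ × ℝ => ‖g (circleMap c p.1 p.2)‖ₑ ^ 2)
      (Set.Ioo 0 r ×ˢ Set.Ioo (-Real.pi) Real.pi) := by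
    refine (ENNReal.continuous_pow 2).comp_continuousOn (continuous_enorm.comp_continuousOn
      (hg.continuousOn.comp (by unfold circleMap; fun_prop) ?_))
    rintro ⟨ρ, θ⟩ ⟨h1, h2⟩
    exact Metric.closedBall_subset_ball h1.2 (circleMap_mem_closedBall c h1.1.le θ)
  have hms : MeasurableSet (Set.Ioo 0 r ×ˢ Set.Ioo (-Real.pi) Real.pi : Set (ℝ × ℝ)) :=
    measurableSet_Ioo.prod measurableSet_Ioo
  calc ENNReal.ofReal (Real.pi * r ^ 2) * ‖g c‖ₑ ^ 2
      = ∫⁻ ρ in Set.Ioo 0 r, ENNReal.ofReal ρ * (ENNReal.ofReal (2 * Real.pi) * ‖g c‖ₑ ^ 2) := by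
        rw [lintegral_mul_const _ (by fun_prop), ← mul_assoc]
        congr 1
        rw [← ofReal_integral_eq_lintegral_ofReal, ← ENNReal.ofReal_mul]
        · congr 1
          rw [← integral_Ioc_eq_integral_Ioo, ← intervalIntegral.integral_of_le hr.le, integral_id]
          ring
        · exact integral_nonneg_of_ae ((ae_restrict_mem measurableSet_Ioo).mono fun x hx => hx.1.le)
        · exact (continuous_id.integrableOn_Icc (a := 0) (b := r)).mono_set Set.Ioo_subset_Icc_self
        · exact (ae_restrict_mem measurableSet_Ioo).mono fun x hx => hx.1.le
    _ ≤ ∫⁻ ρ in Set.Ioo 0 r, ENNReal.ofReal ρ *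
          ∫⁻ θ in Set.Ioo (-Real.pi) Real.pi, ‖g (circleMap c ρ θ)‖ₑ ^ 2 :=
        setLIntegral_mono' measurableSet_Ioo fun ρ hρ => by gcongr; exact key ρ hρ
    _ = ∫⁻ ρ in Set.Ioo 0 r, ∫⁻ θ in Set.Ioo (-Real.pi) Real.pi,
          ENNReal.ofReal ρ * ‖g (circleMap c ρ θ)‖ₑ ^ 2 :=
        lintegral_congr fun ρ => (lintegral_const_mul' _ _ ENNReal.ofReal_ne_top).symm
    _ = ∫⁻ p in Set.Ioo 0 r ×ˢ Set.Ioo (-Real.pi) Real.pi,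
          ENNReal.ofReal p.1 * ‖g (circleMap c p.1 p.2)‖ₑ ^ 2 := by
        rw [Measure.volume_eq_prod, ← Measure.prod_restrict, lintegral_prod]
        rw [Measure.prod_restrict]
        exact (Measurable.aemeasurable (by fun_prop)).mul
          (hcont.aemeasurable hms)
    _ ≤ _ := by
        refine le_trans ?_ (lintegral_mono_set htar)
        refine (setLIntegral_congr_fun hms fun p hp => ?_).le
        simp only [smul_eq_mul, hval p hp]

/-! ### The octant, the tube and horizontal slices -/

theorem isOpen_octant (n : ℕ) : IsOpen (octant n) := by
  simp only [octant, Set.ofPred_forall]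
  exact isOpen_iInter_of_finite fun k => isOpen_lt continuous_const (continuous_apply k)

theorem octant_add {n : ℕ} {y v : Fin n → ℝ} (hy : y ∈ octant n) (hv : v ∈ octant n) :
    y + v ∈ octant n := fun k => add_pos (hy k) (hv k)

theorem octant_smul {n : ℕ} {y : Fin n → ℝ} (hy : y ∈ octant n) {t : ℝ} (ht : 0 < t) :
    t • y ∈ octant n := fun k => mul_pos ht (hy k)

theorem isOpen_tube (n : ℕ) : IsOpen (tube n) :=
  (isOpen_octant n).preimage (by fun_prop : Continuous fun z : Fin n → ℂ => fun k => (z k).im)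

theorem tubePoint_mem {n : ℕ} (x : Fin n → ℝ) {y : Fin n → ℝ} (hy : y ∈ octant n) :
    tubePoint x y ∈ tube n := fun k => by simpa [tubePoint] using hy k

theorem continuous_tubePoint {n : ℕ} :
    Continuous fun p : (Fin n → ℝ) × (Fin n → ℝ) => tubePoint p.1 p.2 := by
  unfold tubePoint; fun_prop

theorem nhdsWithin_octant_neBot (n : ℕ) : (𝓝[octant n] (0 : Fin n → ℝ)).NeBot := by
  rw [← mem_closure_iff_nhdsWithin_neBot]
  have h : Tendsto (fun t : ℝ => t • (1 : Fin n → ℝ)) (𝓝[>] 0) (𝓝 0) := by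
    have : Continuous (fun t : ℝ => t • (1 : Fin n → ℝ)) := by fun_prop
    simpa using (this.tendsto 0).mono_left nhdsWithin_le_nhds
  exact mem_closure_of_tendsto h (eventually_mem_nhdsWithin.mono fun t ht =>
    octant_smul (fun _ => one_pos) ht)

theorem eventually_nhdsWithin_octant_lt {n : ℕ} {y : Fin n → ℝ} (hy : y ∈ octant n) :
    ∀ᶠ η in 𝓝[octant n] (0 : Fin n → ℝ), η ∈ octant n ∧ y - η ∈ octant n := by
  refine eventually_mem_nhdsWithin.and (Filter.Eventually.filter_mono nhdsWithin_le_nhds ?_)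
  have : Continuous fun η : Fin n → ℝ => y - η := by fun_prop
  exact this.continuousAt.eventually_mem ((isOpen_octant n).mem_nhds (by simpa using hy))

theorem eLpNorm_two_sq {X : Type*} [MeasurableSpace X] (μ : Measure X) (f : X → ℂ) :
    eLpNorm f 2 μ ^ 2 = ∫⁻ x, ‖f x‖ₑ ^ 2 ∂μ := by
  have := eLpNorm_nnreal_pow_eq_lintegral (f := f) (μ := μ) (p := 2) (by norm_num)
  simpa only [NNReal.coe_ofNat, ENNReal.rpow_ofNat, ENNReal.coe_ofNat] using this

theorem MemHardy.continuous_slice {n : ℕ} {F : (Fin n → ℂ) → ℂ} (hF : MemHardy F)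
    {y : Fin n → ℝ} (hy : y ∈ octant n) : Continuous fun x => F (tubePoint x y) :=
  hF.1.continuousOn.comp_continuous (continuous_tubePoint.comp (by fun_prop : Continuous
    fun x : Fin n → ℝ => (x, y))) fun x => tubePoint_mem x hy

theorem lintegral_slice_le {n : ℕ} (F : (Fin n → ℂ) → ℂ) {y : Fin n → ℝ} (hy : y ∈ octant n) :
    ∫⁻ x, ‖F (tubePoint x y)‖ₑ ^ 2 ≤ hardyNormSq F :=
  le_iSup₂ (f := fun y _ => ∫⁻ x, ‖F (tubePoint x y)‖ₑ ^ 2) y hy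

theorem MemHardy.memLp_slice {n : ℕ} {F : (Fin n → ℂ) → ℂ} (hF : MemHardy F)
    {y : Fin n → ℝ} (hy : y ∈ octant n) : MemLp (fun x => F (tubePoint x y)) 2 volume := by
  refine ⟨(hF.continuous_slice hy).aestronglyMeasurable, ?_⟩
  have h : eLpNorm (fun x => F (tubePoint x y)) 2 volume ^ 2 < ∞ := by
    rw [eLpNorm_two_sq]
    exact (lintegral_slice_le F hy).trans_lt hF.2
  by_contra h'
  rw [not_lt, top_le_iff] at h'
  simp [h'] at h

open Classical in
/-- The restriction of `F` to the horizontal slice of height `y`, as an element of `L²`. -/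
noncomputable def hardySlice {n : ℕ} (F : (Fin n → ℂ) → ℂ) (y : Fin n → ℝ) :
    Lp ℂ 2 (volume : Measure (Fin n → ℝ)) :=
  if h : MemLp (fun x => F (tubePoint x y)) 2 volume then h.toLp else 0

theorem MemHardy.hardySlice_eq {n : ℕ} {F : (Fin n → ℂ) → ℂ} (hF : MemHardy F)
    {y : Fin n → ℝ} (hy : y ∈ octant n) : hardySlice F y = (hF.memLp_slice hy).toLp := by
  rw [hardySlice, dif_pos (hF.memLp_slice hy)]

theorem MemHardy.coeFn_hardySlice {n : ℕ} {F : (Fin n → ℂ) → ℂ} (hF : MemHardy F)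
    {y : Fin n → ℝ} (hy : y ∈ octant n) : hardySlice F y =ᵐ[volume] fun x => F (tubePoint x y) := by
  rw [hF.hardySlice_eq hy]
  exact MemLp.coeFn_toLp _

theorem MemHardy.enorm_hardySlice_sq {n : ℕ} {F : (Fin n → ℂ) → ℂ} (hF : MemHardy F)
    {y : Fin n → ℝ} (hy : y ∈ octant n) :
    ‖hardySlice F y‖ₑ ^ 2 = ∫⁻ x, ‖F (tubePoint x y)‖ₑ ^ 2 := by
  rw [hF.hardySlice_eq hy, Lp.enorm_toLp, eLpNorm_two_sq]

theorem inner_hardySlice {n : ℕ} {F G : (Fin n → ℂ) → ℂ} (hF : MemHardy F) (hG : MemHardy G)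
    {y y' : Fin n → ℝ} (hy : y ∈ octant n) (hy' : y' ∈ octant n) :
    inner ℂ (hardySlice G y') (hardySlice F y) =
      ∫ x, F (tubePoint x y) * conj (G (tubePoint x y')) := by
  rw [L2.inner_def]
  refine integral_congr_ae ?_
  filter_upwards [hF.coeFn_hardySlice hy, hG.coeFn_hardySlice hy'] with x h1 h2
  rw [h1, h2, RCLike.inner_apply]

/-! ### $L^2$ convergence of slices at the boundary -/

/-- The `L²` inner product of two horizontal slices does not change when the heights are moved in
opposite directions. -/
theorem integral_slice_mul_conj_slice_shift {n : ℕ} {F : (Fin n → ℂ) → ℂ} (hF : MemHardy F)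
    {y y' s : Fin n → ℝ} (hy : y ∈ octant n) (hy' : y' ∈ octant n)
    (hys : y + s ∈ octant n) (hys' : y' - s ∈ octant n) :
    ∫ x, F (tubePoint x y) * conj (F (tubePoint x y')) =
      ∫ x, F (tubePoint x (y + s)) * conj (F (tubePoint x (y' - s))) := by
  -- The two conjugations make the second factor holomorphic in `ζ`. A real translation of `ζ` moves
  -- `x` in both factors by the same vector, so the integral over `x` is unchanged; `ζ = 0` and `ζ =
  -- I` give the two sides.
  set H : ℂ → (Fin n → ℝ) → ℂ := fun ζ x =>
    F (tubePoint x y + ζ • fun k => (s k : ℂ)) * conj (F (tubePoint x y' + conj ζ • fun k => (s k : ℂ)))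
    with hH
  set U : Set ℂ := {ζ | y + ζ.im • s ∈ octant n ∧ y' - ζ.im • s ∈ octant n} with hU
  have e1 : ∀ (x y : Fin n → ℝ) (ζ : ℂ), tubePoint x y + ζ • (fun k => (s k : ℂ)) =
      tubePoint (x + ζ.re • s) (y + ζ.im • s) := by
    intro x y ζ
    ext k
    simp only [tubePoint, Pi.add_apply, Pi.smul_apply, smul_eq_mul]
    conv_lhs => rw [← Complex.re_add_im ζ]
    push_cast
    ring
  have hUo : IsOpen U := by
    refine ((isOpen_octant n).preimage (?_ : Continuous fun ζ : ℂ => y + ζ.im • s)).inter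
      ((isOpen_octant n).preimage (?_ : Continuous fun ζ : ℂ => y' - ζ.im • s)) <;> fun_prop
  have hUc : Convex ℝ U := by
    intro ζ hζ ζ' hζ' a b ha hb hab
    have hk : ∀ p q : ℝ, 0 < p → 0 < q → 0 < a * p + b * q := by
      intro p q hp hq
      rcases ha.eq_or_lt with h | h
      · have : b = 1 := by linarith
        rw [← h, this]; linarith
      · have := mul_pos h hp
        have := mul_nonneg hb hq.le
        linarith
    constructor <;> intro k
    · have := hk _ _ (hζ.1 k) (hζ'.1 k)
      simp at this ⊢
      have hb' : b = 1 - a := by linarith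
      subst hb'
      linarith
    · have := hk _ _ (hζ.2 k) (hζ'.2 k)
      simp at this ⊢
      have hb' : b = 1 - a := by linarith
      subst hb'
      linarith
  have hm1 : ∀ ζ ∈ U, ∀ x, tubePoint x y + ζ • (fun k => (s k : ℂ)) ∈ tube n := by
    intro ζ hζ x
    rw [e1]
    exact tubePoint_mem _ hζ.1
  have e2 : ∀ ζ ∈ U, y' + (conj ζ).im • s ∈ octant n := by
    intro ζ hζ
    have := hζ.2
    rwa [sub_eq_add_neg, ← neg_smul, ← Complex.conj_im] at this
  have hm2 : ∀ ζ ∈ U, ∀ x, tubePoint x y' + conj ζ • (fun k => (s k : ℂ)) ∈ tube n := by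
    intro ζ hζ x
    rw [e1]
    exact tubePoint_mem _ (e2 ζ hζ)
  have hcont : ContinuousOn (Function.uncurry H) (U ×ˢ Set.univ) := by
    have hc (y : Fin n → ℝ) : Continuous fun x : Fin n → ℝ => tubePoint x y :=
      continuous_tubePoint.comp (by fun_prop : Continuous fun x : Fin n → ℝ => (x, y))
    refine ContinuousOn.mul ?_ (Complex.continuous_conj.comp_continuousOn ?_)
    · refine hF.1.continuousOn.comp (Continuous.continuousOn ?_) fun p hp => hm1 p.1 hp.1 p.2
      exact ((hc y).comp continuous_snd).add (continuous_fst.smul continuous_const)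
    · refine hF.1.continuousOn.comp (Continuous.continuousOn ?_) fun p hp => hm2 p.1 hp.1 p.2
      exact ((hc y').comp continuous_snd).add
        ((Complex.continuous_conj.comp continuous_fst).smul continuous_const)
  have hdiff : ∀ x, DifferentiableOn ℂ (fun ζ => H ζ x) U := by
    intro x ζ hζ
    refine DifferentiableAt.differentiableWithinAt (DifferentiableAt.mul ?_ ?_)
    · refine DifferentiableAt.comp ζ
        (hF.1.differentiableAt ((isOpen_tube n).mem_nhds (hm1 ζ hζ x))) ?_
      fun_prop
    · have : DifferentiableAt ℂ (fun ζ => F (tubePoint x y' + ζ • fun k => (s k : ℂ))) (conj ζ) := by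
        refine DifferentiableAt.comp (conj ζ)
          (hF.1.differentiableAt ((isOpen_tube n).mem_nhds (hm2 ζ hζ x))) ?_
        fun_prop
      simpa [Function.comp_def] using this.conj_conj
  have hbound : ∀ ζ ∈ U, ∫⁻ x, ‖H ζ x‖ₑ ≤ hardyNormSq F + hardyNormSq F := by
    intro ζ hζ
    have h1 : ∀ a b : ℝ≥0∞, a * b ≤ a ^ 2 + b ^ 2 := by
      intro a b
      rcases le_total a b with h | h
      · calc a * b ≤ b * b := by gcongr
          _ = b ^ 2 := (sq b).symm
          _ ≤ _ := le_add_self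
      · calc a * b ≤ a * a := by gcongr
          _ = a ^ 2 := (sq a).symm
          _ ≤ _ := le_self_add
    have h2 : ∀ (ζ : ℂ) (y : Fin n → ℝ), y + ζ.im • s ∈ octant n →
        ∫⁻ x, ‖F (tubePoint x y + ζ • fun k => (s k : ℂ))‖ₑ ^ 2 ≤ hardyNormSq F := by
      intro ζ y h
      simp_rw [e1]
      rw [lintegral_add_right_eq_self (fun x => ‖F (tubePoint x (y + ζ.im • s))‖ₑ ^ 2)]
      exact lintegral_slice_le F h
    calc ∫⁻ x, ‖H ζ x‖ₑ ≤ ∫⁻ x, (‖F (tubePoint x y + ζ • fun k => (s k : ℂ))‖ₑ ^ 2 +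
          ‖F (tubePoint x y' + conj ζ • fun k => (s k : ℂ))‖ₑ ^ 2) := by
          refine lintegral_mono fun x => ?_
          simp only [hH, enorm_mul, RCLike.enorm_conj]
          exact h1 _ _
      _ = _ := by
          refine lintegral_add_left ?_ _
          refine Measurable.pow_const (Measurable.enorm ?_) 2
          simp_rw [e1]
          exact ((hF.continuous_slice hζ.1).comp (continuous_add_const _)).measurable
      _ ≤ _ := add_le_add (h2 ζ y hζ.1) (h2 (conj ζ) y' (e2 ζ hζ))
  have htrans : ∀ ζ ∈ U, ∀ t : ℝ, ∫ x, H (ζ + t) x = ∫ x, H ζ x := by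
    intro ζ hζ t
    rw [← integral_add_right_eq_self (fun x => H ζ x) (t • s)]
    congr 1
    ext x
    simp only [hH, e1]
    have h1 : x + (ζ + t).re • s = x + t • s + ζ.re • s := by ext k; simp; ring
    have h2 : x + (conj (ζ + t)).re • s = x + t • s + (conj ζ).re • s := by ext k; simp; ring
    have h3 : (ζ + t).im = ζ.im := by simp
    have h4 : (conj (ζ + t)).im = (conj ζ).im := by simp
    rw [h1, h2, h3, h4]
  have hmain := integral_eq_of_translation_invariant volume hUo hUc hcont hdiff
    (ENNReal.add_ne_top.2 ⟨hF.2.ne, hF.2.ne⟩) hbound htrans (ζ := 0) (ζ' := Complex.I)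
    ⟨by simpa using hy, by simpa using hy'⟩ ⟨by simpa using hys, by simpa using hys'⟩
  simp only [hH, e1] at hmain
  simpa [sub_eq_add_neg] using hmain

theorem inner_hardySlice_self {n : ℕ} {F : (Fin n → ℂ) → ℂ} (hF : MemHardy F)
    {y y' : Fin n → ℝ} (hy : y ∈ octant n) (hy' : y' ∈ octant n) :
    inner ℂ (hardySlice F y') (hardySlice F y) =
      ((‖hardySlice F ((1 / 2 : ℝ) • (y + y'))‖ ^ 2 : ℝ) : ℂ) := by
  have hm := octant_smul (octant_add hy hy') (t := 1 / 2) (by norm_num)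
  have h1 : y + (1 / 2 : ℝ) • (y' - y) = (1 / 2 : ℝ) • (y + y') := by
    ext k; simp; ring
  have h2 : y' - (1 / 2 : ℝ) • (y' - y) = (1 / 2 : ℝ) • (y + y') := by
    ext k; simp; ring
  rw [inner_hardySlice hF hF hy hy', integral_slice_mul_conj_slice_shift hF hy hy'
    (s := (1 / 2 : ℝ) • (y' - y)) (by rwa [h1]) (by rwa [h2]), h1, h2, ← inner_hardySlice hF hF hm hm,
    inner_self_eq_norm_sq_to_K]
  norm_cast

/-- Shifting both heights to their midpoint turns the cross term into a squared norm. Convergence of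
the norms alone therefore forces convergence of the slices, and nonnegativity of the left side makes
the squared norm midpoint convex in the height. -/
theorem norm_hardySlice_sub_sq {n : ℕ} {F : (Fin n → ℂ) → ℂ} (hF : MemHardy F)
    {y y' : Fin n → ℝ} (hy : y ∈ octant n) (hy' : y' ∈ octant n) :
    ‖hardySlice F y - hardySlice F y'‖ ^ 2 = ‖hardySlice F y‖ ^ 2 + ‖hardySlice F y'‖ ^ 2 -
      2 * ‖hardySlice F ((1 / 2 : ℝ) • (y + y'))‖ ^ 2 := by
  rw [norm_sub_sq (𝕜 := ℂ), inner_hardySlice_self hF hy' hy, add_comm y' y]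
  simp only [RCLike.re_to_complex, Complex.ofReal_re]
  ring

theorem norm_hardySlice_sq_le {n : ℕ} {F : (Fin n → ℂ) → ℂ} (hF : MemHardy F)
    {y : Fin n → ℝ} (hy : y ∈ octant n) : ‖hardySlice F y‖ ^ 2 ≤ (hardyNormSq F).toReal := by
  have h := (hF.enorm_hardySlice_sq hy).trans_le (lintegral_slice_le F hy)
  have := ENNReal.toReal_mono hF.2.ne h
  simpa using this

/-- Along `y + j • v` the squared norms form a convex sequence. If its first step were an increase,
it would grow at least linearly, contradicting boundedness. -/
theorem norm_hardySlice_antitone {n : ℕ} {F : (Fin n → ℂ) → ℂ} (hF : MemHardy F)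
    {y v : Fin n → ℝ} (hy : y ∈ octant n) (hv : v ∈ octant n) :
    ‖hardySlice F (y + v)‖ ^ 2 ≤ ‖hardySlice F y‖ ^ 2 := by
  by_contra! hlt
  set a : ℕ → ℝ := fun j => ‖hardySlice F (y + (j : ℝ) • v)‖ ^ 2 with ha
  have hmem : ∀ j : ℕ, y + (j : ℝ) • v ∈ octant n := by
    intro j k
    have := hy k
    have := (hv k).le
    simp only [Pi.add_apply, Pi.smul_apply, smul_eq_mul]
    positivity
  have hconv : ∀ j, 2 * a (j + 1) ≤ a j + a (j + 2) := by
    intro j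
    have h1 := norm_hardySlice_sub_sq hF (hmem j) (hmem (j + 2))
    have h2 : (1 / 2 : ℝ) • (y + (j : ℝ) • v + (y + ((j + 2 : ℕ) : ℝ) • v)) =
        y + ((j + 1 : ℕ) : ℝ) • v := by
      ext k; simp; ring
    rw [h2] at h1
    have h3 := sq_nonneg ‖hardySlice F (y + (j : ℝ) • v) - hardySlice F (y + ((j + 2 : ℕ) : ℝ) • v)‖
    simp only [ha]
    linarith
  have hinc : ∀ j, a 1 - a 0 ≤ a (j + 1) - a j := by
    intro j
    induction j with
    | zero => simp
    | succ j ih => linarith [hconv j]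
  have hlin : ∀ j : ℕ, a 0 + j * (a 1 - a 0) ≤ a j := by
    intro j
    induction j with
    | zero => simp
    | succ j ih => push_cast; linarith [hinc j]
  have hpos : 0 < a 1 - a 0 := by simpa [ha] using hlt
  obtain ⟨j, hj⟩ := exists_nat_gt ((hardyNormSq F).toReal / (a 1 - a 0))
  rw [div_lt_iff₀ hpos] at hj
  have h0 : 0 ≤ a 0 := sq_nonneg _
  linarith [hlin j, norm_hardySlice_sq_le hF (hmem j)]

/-- By monotonicity the squared norms are close to their supremum at all heights below a suitable
`y₀`, midpoints included, so the midpoint identity makes the slices Cauchy. -/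
theorem exists_tendsto_hardySlice {n : ℕ} {F : (Fin n → ℂ) → ℂ} (hF : MemHardy F) :
    ∃ f, Tendsto (hardySlice F) (𝓝[octant n] 0) (𝓝 f) := by
  have := nhdsWithin_octant_neBot n
  refine CompleteSpace.complete (f := map (hardySlice F) (𝓝[octant n] 0)) ?_
  rw [Metric.cauchy_iff]
  refine ⟨inferInstance, fun ε hε => ?_⟩
  set A : Set ℝ := (fun y => ‖hardySlice F y‖ ^ 2) '' octant n with hA
  have hbdd : BddAbove A := ⟨(hardyNormSq F).toReal, by
    rintro _ ⟨y, hy, rfl⟩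
    exact norm_hardySlice_sq_le hF hy⟩
  have hone : (1 : Fin n → ℝ) ∈ octant n := fun _ => one_pos
  have hne : A.Nonempty := ⟨_, 1, hone, rfl⟩
  -- With margin $\varepsilon^2/2$ the midpoint identity gives less than
  -- $2\sup-2(\sup-\varepsilon^2/2)=\varepsilon^2$.
  obtain ⟨_, ⟨y₀, hy₀, rfl⟩, hlt⟩ := exists_lt_of_lt_csSup hne
    (show sSup A - ε ^ 2 / 2 < sSup A by have := pow_pos hε 2; linarith)
  have hlow : ∀ y ∈ octant n, y₀ - y ∈ octant n → sSup A - ε ^ 2 / 2 < ‖hardySlice F y‖ ^ 2 := by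
    intro y hy hy'
    refine hlt.trans_le ?_
    simpa using norm_hardySlice_antitone hF hy hy'
  refine ⟨hardySlice F '' {η | η ∈ octant n ∧ y₀ - η ∈ octant n},
    image_mem_map (eventually_nhdsWithin_octant_lt hy₀), ?_⟩
  rintro _ ⟨y, ⟨hy, hyl⟩, rfl⟩ _ ⟨y', ⟨hy', hyl'⟩, rfl⟩
  have h1 := le_csSup hbdd ⟨y, hy, rfl⟩
  have h2 := le_csSup hbdd ⟨y', hy', rfl⟩
  have h3 := hlow ((1 / 2 : ℝ) • (y + y')) (octant_smul (octant_add hy hy') (by norm_num)) (by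
    have := octant_smul (octant_add hyl hyl') (t := 1 / 2) (by norm_num)
    convert this using 1
    ext k; simp; ring)
  have h4 := norm_hardySlice_sub_sq hF hy hy'
  rw [dist_eq_norm]
  simp only at h1 h2
  exact lt_of_pow_lt_pow_left₀ 2 hε.le (by linarith)

/-! ### The Hardy space and its boundary values -/

/-- The Hardy space `H²` of the tube, as a space of functions. -/
def hardySpace (n : ℕ) : Submodule ℂ ((Fin n → ℂ) → ℂ) where
  carrier := {F | MemHardy F}
  zero_mem' := ⟨differentiableOn_const 0, by simp [hardyNormSq]⟩
  add_mem' := by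
    intro F G hF hG
    refine ⟨hF.1.add hG.1, lt_of_le_of_lt (b := 2 * hardyNormSq F + 2 * hardyNormSq G) ?_ ?_⟩
    · refine iSup₂_le fun y hy => ?_
      have h1 : ∀ a b : ℂ, ‖a + b‖ₑ ^ 2 ≤ 2 * ‖a‖ₑ ^ 2 + 2 * ‖b‖ₑ ^ 2 := by
        intro a b
        have h2 : ‖a + b‖₊ ^ 2 ≤ 2 * ‖a‖₊ ^ 2 + 2 * ‖b‖₊ ^ 2 := by
          rw [← NNReal.coe_le_coe]
          push_cast
          have := pow_le_pow_left₀ (norm_nonneg _) (norm_add_le a b) 2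
          nlinarith [sq_nonneg (‖a‖ - ‖b‖)]
        simp only [enorm_eq_nnnorm]
        exact_mod_cast h2
      calc ∫⁻ x, ‖(F + G) (tubePoint x y)‖ₑ ^ 2
          ≤ ∫⁻ x, (2 * ‖F (tubePoint x y)‖ₑ ^ 2 + 2 * ‖G (tubePoint x y)‖ₑ ^ 2) :=
            lintegral_mono fun x => h1 _ _
        _ = 2 * (∫⁻ x, ‖F (tubePoint x y)‖ₑ ^ 2) + 2 * ∫⁻ x, ‖G (tubePoint x y)‖ₑ ^ 2 := by
            have hm := ((MemHardy.continuous_slice hF hy).measurable.enorm.pow_const 2)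
            rw [lintegral_add_left (hm.const_mul 2), lintegral_const_mul' _ _ (by simp),
              lintegral_const_mul' _ _ (by simp)]
        _ ≤ _ := by gcongr <;> exact lintegral_slice_le _ hy
    · exact ENNReal.add_lt_top.2 ⟨ENNReal.mul_lt_top (by simp) hF.2, ENNReal.mul_lt_top (by simp) hG.2⟩
  smul_mem' := by
    intro c F hF
    refine ⟨hF.1.const_smul c, lt_of_le_of_lt (b := ‖c‖ₑ ^ 2 * hardyNormSq F) ?_
      (ENNReal.mul_lt_top (by simp) hF.2)⟩
    refine iSup₂_le fun y hy => ?_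
    simp only [Pi.smul_apply, smul_eq_mul, enorm_mul, mul_pow]
    rw [lintegral_const_mul' _ _ (by simp)]
    gcongr
    exact lintegral_slice_le _ hy

theorem MemHardy.hardySlice_add {n : ℕ} {F G : (Fin n → ℂ) → ℂ} (hF : MemHardy F)
    (hG : MemHardy G) {y : Fin n → ℝ} (hy : y ∈ octant n) :
    hardySlice (F + G) y = hardySlice F y + hardySlice G y := by
  rw [hF.hardySlice_eq hy, hG.hardySlice_eq hy,
    MemHardy.hardySlice_eq ((hardySpace n).add_mem hF hG) hy]
  rfl

theorem MemHardy.hardySlice_smul {n : ℕ} {F : (Fin n → ℂ) → ℂ} (c : ℂ) (hF : MemHardy F)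
    {y : Fin n → ℝ} (hy : y ∈ octant n) : hardySlice (c • F) y = c • hardySlice F y := by
  rw [hF.hardySlice_eq hy, MemHardy.hardySlice_eq ((hardySpace n).smul_mem c hF) hy]
  rfl

/-- The boundary values of the functions in the Hardy space. -/
noncomputable def boundaryValue (n : ℕ) :
    hardySpace n →ₗ[ℂ] Lp ℂ 2 (volume : Measure (Fin n → ℝ)) where
  toFun F := (exists_tendsto_hardySlice F.2).choose
  map_add' F G := by
    have := nhdsWithin_octant_neBot n
    refine tendsto_nhds_unique (exists_tendsto_hardySlice (F + G).2).choose_spec ?_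
    refine ((exists_tendsto_hardySlice F.2).choose_spec.add
      (exists_tendsto_hardySlice G.2).choose_spec).congr' ?_
    filter_upwards [eventually_mem_nhdsWithin] with y hy
    exact (MemHardy.hardySlice_add F.2 G.2 hy).symm
  map_smul' c F := by
    have := nhdsWithin_octant_neBot n
    refine tendsto_nhds_unique (exists_tendsto_hardySlice (c • F).2).choose_spec ?_
    refine ((exists_tendsto_hardySlice F.2).choose_spec.const_smul c).congr' ?_
    filter_upwards [eventually_mem_nhdsWithin] with y hy
    exact (MemHardy.hardySlice_smul c F.2 hy).symm

theorem tendsto_hardySlice {n : ℕ} (F : hardySpace n) :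
    Tendsto (hardySlice (F : (Fin n → ℂ) → ℂ)) (𝓝[octant n] 0) (𝓝 (boundaryValue n F)) :=
  (exists_tendsto_hardySlice F.2).choose_spec

/-- Limits in $L^2$ are unique, so the arbitrary representative chosen in `limitFunction` is
harmless and `hardyInner` becomes an honest $L^2$ inner product. -/
theorem isLimitFunction_iff {n : ℕ} (F : hardySpace n) {f : (Fin n → ℝ) → ℂ} :
    IsLimitFunction (F : (Fin n → ℂ) → ℂ) f ↔ f =ᵐ[volume] boundaryValue n F := by
  have := nhdsWithin_octant_neBot n
  have key : ∀ hf : MemLp f 2 volume,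
      (Tendsto (fun η : Fin n → ℝ => eLpNorm (fun ξ => F.1 (tubePoint ξ η) - f ξ) 2 volume)
      (𝓝[octant n] 0) (𝓝 0) ↔ hf.toLp = boundaryValue n F) := by
    intro hf
    have h1 : (fun η : Fin n → ℝ => eLpNorm (fun ξ => F.1 (tubePoint ξ η) - f ξ) 2 volume)
        =ᶠ[𝓝[octant n] 0] fun η => eLpNorm (⇑(hardySlice F.1 η) - f) 2 volume := by
      filter_upwards [eventually_mem_nhdsWithin] with y hy
      refine eLpNorm_congr_ae ?_
      filter_upwards [MemHardy.coeFn_hardySlice F.2 hy] with x hx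
      simp [hx]
    rw [tendsto_congr' h1, ← Lp.tendsto_Lp_iff_tendsto_eLpNorm'' _ (fun η => Lp.memLp _) f hf]
    simp only [Lp.toLp_coeFn]
    exact ⟨fun h => tendsto_nhds_unique h (tendsto_hardySlice F),
      fun h => h ▸ tendsto_hardySlice F⟩
  constructor
  · rintro ⟨hf, h⟩
    rw [← (key hf).1 h]
    exact hf.coeFn_toLp.symm
  · intro h
    have hf : MemLp f 2 volume := (memLp_congr_ae h).2 (Lp.memLp _)
    refine ⟨hf, (key hf).2 ?_⟩
    rw [← Lp.toLp_coeFn (boundaryValue n F) (Lp.memLp _)]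
    exact MemLp.toLp_congr _ _ h

theorem limitFunction_ae_eq {n : ℕ} (F : hardySpace n) :
    limitFunction (F : (Fin n → ℂ) → ℂ) =ᵐ[volume] boundaryValue n F := by
  have h : ∃ f, IsLimitFunction (F : (Fin n → ℂ) → ℂ) f :=
    ⟨boundaryValue n F, (isLimitFunction_iff F).2 (ae_eq_refl _)⟩
  rw [limitFunction, dif_pos h]
  exact (isLimitFunction_iff F).1 h.choose_spec

theorem hardyInner_eq_inner {n : ℕ} (F G : hardySpace n) :
    hardyInner (F : (Fin n → ℂ) → ℂ) G = inner ℂ (boundaryValue n G) (boundaryValue n F) := by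
  rw [L2.inner_def, hardyInner]
  refine integral_congr_ae ?_
  filter_upwards [limitFunction_ae_eq F, limitFunction_ae_eq G] with x h1 h2
  rw [h1, h2, RCLike.inner_apply]

/-- Slice norms grow as the height decreases to 0, so their supremum is their limit at the boundary.
-/
theorem hardyNormSq_eq_enorm_sq {n : ℕ} (F : hardySpace n) :
    hardyNormSq (F : (Fin n → ℂ) → ℂ) = ‖boundaryValue n F‖ₑ ^ 2 := by
  have := nhdsWithin_octant_neBot n
  have hlim : Tendsto (fun y => ‖hardySlice F.1 y‖ ^ 2) (𝓝[octant n] 0)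
      (𝓝 (‖boundaryValue n F‖ ^ 2)) := ((tendsto_hardySlice F).norm).pow 2
  have hF : MemHardy F.1 := F.2
  have e : ∀ f : Lp ℂ 2 (volume : Measure (Fin n → ℝ)), ‖f‖ₑ ^ 2 = ENNReal.ofReal (‖f‖ ^ 2) :=
    fun f => by rw [ENNReal.ofReal_pow (norm_nonneg _), ofReal_norm]
  refine le_antisymm (iSup₂_le fun y hy => ?_) ?_
  · rw [← hF.enorm_hardySlice_sq hy, e, e]
    refine ENNReal.ofReal_le_ofReal (ge_of_tendsto hlim ?_)
    filter_upwards [eventually_nhdsWithin_octant_lt hy] with η hη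
    simpa using norm_hardySlice_antitone hF hη.1 hη.2
  · rw [e]
    refine ENNReal.ofReal_le_of_le_toReal (le_of_tendsto hlim ?_)
    filter_upwards [eventually_mem_nhdsWithin] with y hy
    exact norm_hardySlice_sq_le hF hy

/-! ### Cauchy kernel estimates and shifts of horizontal lines -/

theorem lintegral_enorm_mul_sq_le {X : Type*} [MeasurableSpace X] {μ : Measure X} {f g : X → ℂ}
    (hf : AEStronglyMeasurable f μ) (hg : AEStronglyMeasurable g μ) :
    (∫⁻ x, ‖f x * g x‖ₑ ∂μ) ^ 2 ≤ (∫⁻ x, ‖f x‖ₑ ^ 2 ∂μ) * ∫⁻ x, ‖g x‖ₑ ^ 2 ∂μ := by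
  have h := ENNReal.lintegral_mul_le_Lp_mul_Lq μ (p := 2) (q := 2) Real.HolderConjugate.two_two hf.enorm hg.enorm
  simp only [Pi.mul_apply, ← enorm_mul, ENNReal.rpow_ofNat] at h
  refine (pow_le_pow_left' h 2).trans_eq ?_
  rw [mul_pow, ← ENNReal.rpow_natCast, ← ENNReal.rpow_natCast, ← ENNReal.rpow_mul,
    ← ENNReal.rpow_mul]
  norm_num

/-- Comparison with $v^{-2}(1+((x-\operatorname{Re}p)/v)^2)^{-1}$, whose integral is $\pi/v$. The
decay in `v` is what allows lines to be pushed to infinity. -/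
theorem lintegral_enorm_inv_sub_sq_le {p : ℂ} {y v : ℝ} (hv : 0 < v) (hy : v ≤ |y - p.im|) :
    ∫⁻ x : ℝ, ‖((x : ℂ) + y * Complex.I - p)⁻¹‖ₑ ^ 2 ≤ ENNReal.ofReal (Real.pi / v) := by
  have h1 : ∀ x : ℝ, ‖((x : ℂ) + y * Complex.I - p)⁻¹‖ₑ ^ 2 ≤
      ENNReal.ofReal ((v ^ 2)⁻¹ * (1 + ((x - p.re) / v) ^ 2)⁻¹) := by
    intro x
    rw [← ofReal_norm, ← ENNReal.ofReal_pow (norm_nonneg _)]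
    refine ENNReal.ofReal_le_ofReal ?_
    rw [norm_inv, inv_pow, ← Complex.normSq_eq_norm_sq, Complex.normSq_apply, ← mul_inv]
    have hsq : v ^ 2 ≤ (y - p.im) ^ 2 := by
      rw [← sq_abs (y - p.im)]; gcongr
    have e : v ^ 2 * (1 + ((x - p.re) / v) ^ 2) = v ^ 2 + (x - p.re) ^ 2 := by
      field_simp
    rw [e]
    refine inv_anti₀ (by positivity) ?_
    simp
    nlinarith
  have hint : Integrable fun x : ℝ => (1 + ((x - p.re) / v) ^ 2)⁻¹ :=
    ((integrable_inv_one_add_sq.comp_div hv.ne').comp_sub_right p.re)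
  refine (lintegral_mono h1).trans_eq ?_
  rw [← ofReal_integral_eq_lintegral_ofReal (hint.const_mul _)
    (Eventually.of_forall fun x => by positivity)]
  congr 1
  rw [integral_const_mul, integral_sub_right_eq_self (fun x => (1 + (x / v) ^ 2)⁻¹),
    Measure.integral_comp_div (fun x => (1 + x ^ 2)⁻¹), integral_univ_inv_one_add_sq,
    abs_of_pos hv, smul_eq_mul]
  field_simp

/-- Real translations do not change the integral of `h (x + ζ)` over `x`, so it is constant in `ζ`.
The uniform $L^1$ bound replaces any estimate on vertical sides of a contour. -/
theorem integral_horizontal_eq {h : ℂ → ℂ} {a b : ℝ}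
    (hd : DifferentiableOn ℂ h {z | a < z.im ∧ z.im < b}) {M : ℝ≥0∞} (hM : M ≠ ∞)
    (hb : ∀ y ∈ Set.Ioo a b, ∫⁻ x : ℝ, ‖h (x + y * Complex.I)‖ₑ ≤ M) {y y' : ℝ}
    (hy : y ∈ Set.Ioo a b) (hy' : y' ∈ Set.Ioo a b) :
    ∫ x : ℝ, h (x + y * Complex.I) = ∫ x : ℝ, h (x + y' * Complex.I) := by
  have hUo : IsOpen {z : ℂ | a < z.im ∧ z.im < b} :=
    (isOpen_lt continuous_const Complex.continuous_im).inter
      (isOpen_lt Complex.continuous_im continuous_const)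
  have hUc : Convex ℝ {z : ℂ | a < z.im ∧ z.im < b} :=
    (convex_halfSpace_im_gt a).inter (convex_halfSpace_im_lt b)
  have e : ∀ (ζ : ℂ) (x : ℝ), (x : ℂ) + ζ = ((x + ζ.re : ℝ) : ℂ) + ζ.im * Complex.I := by
    intro ζ x
    conv_lhs => rw [← Complex.re_add_im ζ]
    push_cast
    ring
  refine integral_eq_of_translation_invariant volume hUo hUc (H := fun ζ (x : ℝ) => h ((x : ℂ) + ζ))
    (ζ := y * Complex.I) (ζ' := y' * Complex.I) ?_ ?_ hM ?_ ?_ (by simpa using hy)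
    (by simpa using hy')
  · refine hd.continuousOn.comp (by fun_prop) fun p hp => ?_
    have h1 : ((p.2 : ℂ) + p.1).im = p.1.im := by simp
    exact ⟨h1 ▸ hp.1.1, h1 ▸ hp.1.2⟩
  · intro x
    exact hd.comp (by fun_prop) fun ζ hζ => by simpa using hζ
  · intro ζ hζ
    have h1 : ∫⁻ x : ℝ, ‖h ((x : ℂ) + ζ)‖ₑ =
        ∫⁻ x : ℝ, ‖h (((x + ζ.re : ℝ) : ℂ) + ζ.im * Complex.I)‖ₑ :=
      lintegral_congr fun x => congrArg (fun z => ‖h z‖ₑ) (e ζ x)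
    rw [h1, lintegral_add_right_eq_self (fun x : ℝ => ‖h (x + ζ.im * Complex.I)‖ₑ)]
    exact hb _ hζ
  · intro ζ hζ t
    rw [← integral_add_right_eq_self (fun x : ℝ => h ((x : ℂ) + ζ)) t]
    congr 1
    ext x
    congr 1
    push_cast
    ring

theorem lintegral_ball_le {f : ℂ → ℝ≥0∞} {c : ℂ} {r : ℝ}
    (hf : AEMeasurable f (volume.restrict {z | z.im ∈ Set.Ioo (c.im - r) (c.im + r)})) :
    ∫⁻ z in Metric.ball c r, f z ≤
      ∫⁻ y in Set.Ioo (c.im - r) (c.im + r), ∫⁻ x : ℝ, f (x + y * Complex.I) := by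
  set S : Set ℂ := {z | z.im ∈ Set.Ioo (c.im - r) (c.im + r)} with hS
  have hsub : Metric.ball c r ⊆ S := by
    intro z hz
    have h1 := (Complex.abs_im_le_norm (z - c)).trans_lt (by simpa [dist_eq_norm] using hz)
    rw [Complex.sub_im, abs_lt] at h1
    exact ⟨by linarith, by linarith⟩
  refine (lintegral_mono_set hsub).trans_eq ?_
  have hvp := Complex.volume_preserving_equiv_real_prod.symm
  have hpre : Complex.measurableEquivRealProd.symm ⁻¹' S =
      Set.univ ×ˢ Set.Ioo (c.im - r) (c.im + r) := by
    ext p; simp [hS, Complex.measurableEquivRealProd]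
  have hr := hvp.restrict_preimage_emb (MeasurableEquiv.measurableEmbedding _) S
  rw [← hr.lintegral_comp_emb (MeasurableEquiv.measurableEmbedding _), hpre,
    Measure.volume_eq_prod, ← Measure.prod_restrict, Measure.restrict_univ, lintegral_prod_symm]
  · refine lintegral_congr fun y => lintegral_congr fun x => ?_
    simp [Complex.measurableEquivRealProd, Complex.equivRealProdCLM_symm_apply]
  · rw [hpre, Measure.volume_eq_prod, ← Measure.prod_restrict, Measure.restrict_univ] at hr
    exact hf.comp_quasiMeasurePreserving hr.quasiMeasurePreserving

/-! ### The Cauchy formula in the upper half-plane -/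

section HalfPlane

variable {g : ℂ → ℂ} (hg : DifferentiableOn ℂ g {z | 0 < z.im}) {M : ℝ≥0∞} (hM : M ≠ ∞)
  (hb : ∀ y : ℝ, 0 < y → ∫⁻ x : ℝ, ‖g (x + y * Complex.I)‖ₑ ^ 2 ≤ M)

theorem isOpen_halfPlane : IsOpen {z : ℂ | 0 < z.im} :=
  isOpen_lt continuous_const Complex.continuous_im

include hg in
theorem continuous_horizontal {y : ℝ} (hy : 0 < y) : Continuous fun x : ℝ => g (x + y * Complex.I) :=
  hg.continuousOn.comp_continuous (by fun_prop) fun x => by simpa using hy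

include hg hM hb in
-- The disc of radius `a` about `z` lies in a strip of width `2 * a` inside the half-plane; the area
-- mean value inequality and the slice bounds on that strip give a constant independent of `z`.
theorem exists_norm_le_of_le_im {a : ℝ} (ha : 0 < a) : ∃ C, ∀ z : ℂ, a ≤ z.im → ‖g z‖ ≤ C := by
  set K : ℝ≥0∞ := M * ENNReal.ofReal (2 * a) / ENNReal.ofReal (Real.pi * a ^ 2) with hK
  have hpos : 0 < Real.pi * a ^ 2 := by have := Real.pi_pos; positivity
  have hKtop : K ≠ ∞ := by
    exact ENNReal.div_ne_top (ENNReal.mul_ne_top hM ENNReal.ofReal_ne_top) (by simpa using hpos)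
  refine ⟨Real.sqrt K.toReal, fun z hz => Real.le_sqrt_of_sq_le ?_⟩
  have hstrip : ∀ w : ℂ, w.im ∈ Set.Ioo (z.im - a) (z.im + a) → 0 < w.im := fun w hw => by
    have := hw.1; linarith
  have h1 := enorm_sq_le_lintegral_ball (g := g) (c := z) ha (hg.mono fun w hw => by
    have h2 := (Complex.abs_im_le_norm (w - z)).trans_lt (by simpa [dist_eq_norm] using hw)
    rw [Complex.sub_im, abs_lt] at h2
    exact hstrip w ⟨by linarith, by linarith⟩)
  have hmS : MeasurableSet {w : ℂ | w.im ∈ Set.Ioo (z.im - a) (z.im + a)} :=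
    Complex.measurable_im measurableSet_Ioo
  have h3 := h1.trans (lintegral_ball_le (((ENNReal.continuous_pow 2).comp_continuousOn
    (continuous_enorm.comp_continuousOn (hg.continuousOn.mono hstrip))).aemeasurable hmS))
  have h4 : ENNReal.ofReal (Real.pi * a ^ 2) * ‖g z‖ₑ ^ 2 ≤ M * ENNReal.ofReal (2 * a) := by
    refine h3.trans ((setLIntegral_mono' measurableSet_Ioo fun y hy =>
      hb y (by have := hy.1; linarith)).trans_eq ?_)
    rw [setLIntegral_const, Real.volume_Ioo]
    congr 2
    ring
  have h5 : ‖g z‖ₑ ^ 2 ≤ K := by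
    rw [hK, ENNReal.le_div_iff_mul_le (Or.inl (by simpa using hpos)) (Or.inl ENNReal.ofReal_ne_top),
      mul_comm]
    exact h4
  have := ENNReal.toReal_mono hKtop h5
  simpa using this

include hg hM hb in
/-- The integral of `g(z) / (z - p)` along a horizontal line above `p` vanishes. -/
theorem integral_mul_inv_sub_eq_zero {p : ℂ} {y : ℝ} (hy : 0 < y) (hp : p.im < y) :
    ∫ x : ℝ, g (x + y * Complex.I) * (x + y * Complex.I - p)⁻¹ = 0 := by
  -- Above height `a` the function `g` is holomorphic and the distance to `p` is at least `v = (y -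
  -- p.im) / 2`.
  set a : ℝ := max 0 ((p.im + y) / 2) with ha
  have hay : a < y := max_lt hy (by linarith)
  have ha0 : 0 ≤ a := le_max_left _ _
  have hpa : (p.im + y) / 2 ≤ a := le_max_right _ _
  set v : ℝ := (y - p.im) / 2 with hv
  have hv0 : 0 < v := by rw [hv]; linarith
  have hne : ∀ z : ℂ, a < z.im → z - p ≠ 0 := fun z hz h0 => by
    rw [sub_eq_zero.1 h0] at hz; linarith
  have hd : ∀ b : ℝ, DifferentiableOn ℂ (fun z => g z * (z - p)⁻¹) {z | a < z.im ∧ z.im < b} := by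
    intro b z hz
    have h1 := hg.differentiableAt (isOpen_halfPlane.mem_nhds (ha0.trans_lt hz.1))
    exact (h1.mul ((differentiableAt_id.sub_const p).inv (hne z hz.1))).differentiableWithinAt
  have hcs : ∀ y' v' : ℝ, a < y' → 0 < v' → v' ≤ y' - p.im →
      (∫⁻ x : ℝ, ‖g (x + y' * Complex.I) * ((x : ℂ) + y' * Complex.I - p)⁻¹‖ₑ) ^ 2 ≤
        M * ENNReal.ofReal (Real.pi / v') := by
    intro y' v' hy' hv' hle
    refine (lintegral_enorm_mul_sq_le
      (continuous_horizontal hg (ha0.trans_lt hy')).aestronglyMeasurable ?_).trans ?_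
    · refine Continuous.aestronglyMeasurable (Continuous.inv₀ (by fun_prop) fun x => hne _ ?_)
      simpa using hy'
    · exact mul_le_mul' (hb y' (ha0.trans_lt hy'))
        (lintegral_enorm_inv_sub_sq_le hv' (hle.trans (le_abs_self _)))
  -- The integral keeps its value on any higher line, where Cauchy–Schwarz bounds it by a quantity
  -- tending to 0.
  have hconst : ∀ y' : ℝ, y < y' → (‖∫ x : ℝ, g (x + y * Complex.I) *
      ((x : ℂ) + y * Complex.I - p)⁻¹‖ₑ) ^ 2 ≤ M * ENNReal.ofReal (Real.pi / (y' - p.im)) := by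
    intro y' hyy'
    rw [integral_horizontal_eq (hd (y' + 1)) (M := (M * ENNReal.ofReal (Real.pi / v)) ^ (1 / 2 : ℝ))
      (ENNReal.rpow_ne_top_of_nonneg (by norm_num) (ENNReal.mul_ne_top hM ENNReal.ofReal_ne_top))
      (fun t ht => ?_) (y := y) (y' := y') ⟨hay, by linarith⟩ ⟨by linarith, by linarith⟩]
    · refine (pow_le_pow_left' (enorm_integral_le_lintegral_enorm _) 2).trans ?_
      exact hcs y' _ (by linarith) (by linarith) le_rfl
    · have h1 := ENNReal.rpow_le_rpow (hcs t v ht.1 hv0 (by rw [hv]; linarith [ht.1]))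
        (show (0 : ℝ) ≤ 1 / 2 by norm_num)
      rw [← ENNReal.rpow_natCast, ← ENNReal.rpow_mul] at h1
      simpa using h1
  have hlim : Tendsto (fun y' : ℝ => M * ENNReal.ofReal (Real.pi / (y' - p.im))) atTop (𝓝 0) := by
    have h1 : Tendsto (fun y' : ℝ => Real.pi / (y' - p.im)) atTop (𝓝 0) :=
      tendsto_const_nhds.div_atTop (tendsto_atTop_add_const_right _ _ tendsto_id)
    have h2 := ENNReal.Tendsto.const_mul (a := M) (ENNReal.tendsto_ofReal h1) (Or.inr hM)
    simpa using h2
  have := ge_of_tendsto hlim ((eventually_gt_atTop y).mono hconst)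
  simpa using this

include hg hM hb in
/-- The Cauchy formula for functions in the Hardy space of the upper half-plane. -/
theorem cauchy_formula_halfPlane {η : ℝ} (hη : 0 < η) {w : ℂ} (hw : η < w.im) :
    ∫ x : ℝ, g (x + η * Complex.I) * (2 * Real.pi * Complex.I * (x + η * Complex.I - w))⁻¹ =
      g w := by
  have hw0 : 0 < w.im := hη.trans hw
  set A : ℝ → ℂ := fun y => ∫ x : ℝ, g (x + y * Complex.I) * ((x : ℂ) + y * Complex.I - w)⁻¹ with hA
  have hintK : ∀ y y' : ℝ, 0 < y → ∀ p : ℂ, p.im ≠ y' → Integrable fun x : ℝ =>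
      g (x + y * Complex.I) * ((x : ℂ) + y' * Complex.I - p)⁻¹ := by
    intro y y' hy p hp
    have hne : ∀ x : ℝ, (x : ℂ) + y' * Complex.I - p ≠ 0 := fun x h0 => by
      have := congrArg Complex.im h0
      simp at this
      exact hp (by linarith)
    have hc := continuous_horizontal hg hy
    have hc' : Continuous fun x : ℝ => ((x : ℂ) + y' * Complex.I - p)⁻¹ :=
      Continuous.inv₀ (by fun_prop) hne
    refine ⟨(hc.mul hc').aestronglyMeasurable, ?_⟩
    rw [hasFiniteIntegral_iff_enorm]
    have h1 := (lintegral_enorm_mul_sq_le hc.aestronglyMeasurable (μ := volume)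
      hc'.aestronglyMeasurable).trans (mul_le_mul' (hb y hy)
        (lintegral_enorm_inv_sub_sq_le (abs_pos.2 (sub_ne_zero.2 hp.symm)) le_rfl))
    have h2 := h1.trans_lt (ENNReal.mul_lt_top hM.lt_top ENNReal.ofReal_lt_top)
    by_contra h'
    rw [not_lt, top_le_iff] at h'
    rw [h'] at h2
    simp at h2
  have hconst : ∀ y ∈ Set.Ioo 0 w.im, A η = A y := by
    intro y hy
    set b : ℝ := (max η y + w.im) / 2 with hbdef
    have hmax : max η y < w.im := max_lt hw hy.2
    have hbw : b < w.im := by rw [hbdef]; linarith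
    have hb1 : η < b := by have := le_max_left η y; rw [hbdef]; linarith
    have hb2 : y < b := by have := le_max_right η y; rw [hbdef]; linarith
    refine integral_horizontal_eq (h := fun z => g z * (z - w)⁻¹) (a := 0) (b := b)
      (M := (M * ENNReal.ofReal (Real.pi / (w.im - b))) ^ (1 / 2 : ℝ)) ?_
      (ENNReal.rpow_ne_top_of_nonneg (by norm_num) (ENNReal.mul_ne_top hM ENNReal.ofReal_ne_top))
      ?_ ⟨hη, hb1⟩ ⟨hy.1, hb2⟩
    · intro z hz
      have h1 := hg.differentiableAt (isOpen_halfPlane.mem_nhds hz.1)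
      exact (h1.mul ((differentiableAt_id.sub_const w).inv (fun h0 => by
        have := hz.2
        have h0' : z = w := sub_eq_zero.1 h0
        rw [h0'] at this
        linarith))).differentiableWithinAt
    · intro t ht
      have hc := continuous_horizontal hg ht.1
      have hc' : Continuous fun x : ℝ => ((x : ℂ) + t * Complex.I - w)⁻¹ :=
        Continuous.inv₀ (by fun_prop) fun x h0 => by
          have := congrArg Complex.im h0
          simp at this
          linarith [ht.2]
      have h1 := (lintegral_enorm_mul_sq_le hc.aestronglyMeasurable (μ := volume)
        hc'.aestronglyMeasurable).trans (mul_le_mul' (hb t ht.1)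
          (lintegral_enorm_inv_sub_sq_le (v := w.im - b) (by linarith) (by
            rw [abs_sub_comm]; exact (by linarith [ht.2] : w.im - b ≤ w.im - t).trans (le_abs_self _))))
      have h2 := ENNReal.rpow_le_rpow h1 (show (0 : ℝ) ≤ 1 / 2 by norm_num)
      rw [← ENNReal.rpow_natCast, ← ENNReal.rpow_mul] at h2
      simpa using h2
  -- At height `w.im - τ`, the integral with pole `w - 2 * τ * I`, the reflection of `w` in that
  -- line, vanishes. Subtracting it turns the Cauchy kernel into a Poisson kernel, and `x = w.re + τ
  -- * s` rescales it to $2i/(1+s^2)$.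
  have hpoisson : ∀ τ ∈ Set.Ioo 0 w.im, A η = ∫ s : ℝ,
      g (w + (τ * s : ℝ) - τ * Complex.I) * (2 * Complex.I * ((1 + s ^ 2 : ℝ) : ℂ)⁻¹) := by
    intro τ hτ
    have hy : 0 < w.im - τ := by linarith [hτ.2]
    rw [hconst (w.im - τ) ⟨hy, by linarith [hτ.1]⟩]
    have hzero := integral_mul_inv_sub_eq_zero hg hM hb (p := w - 2 * τ * Complex.I) hy
      (by simp; linarith [hτ.1])
    have e1 : A (w.im - τ) = ∫ x : ℝ, g (x + (w.im - τ : ℝ) * Complex.I) *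
        (((x : ℂ) + (w.im - τ : ℝ) * Complex.I - w)⁻¹ -
          ((x : ℂ) + (w.im - τ : ℝ) * Complex.I - (w - 2 * τ * Complex.I))⁻¹) := by
      simp_rw [mul_sub]
      rw [integral_sub (hintK _ _ hy _ (by intro h; linarith [hτ.1])) (hintK _ _ hy _ ?_), hzero, sub_zero]
      simp
      linarith [hτ.1]
    rw [e1, ← integral_add_right_eq_self _ w.re]
    have e2 := Measure.integral_comp_mul_left (fun x : ℝ =>
      g (((x + w.re : ℝ) : ℂ) + (w.im - τ : ℝ) * Complex.I) *
        ((((x + w.re : ℝ) : ℂ) + (w.im - τ : ℝ) * Complex.I - w)⁻¹ -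
          (((x + w.re : ℝ) : ℂ) + (w.im - τ : ℝ) * Complex.I - (w - 2 * τ * Complex.I))⁻¹)) τ
    rw [abs_of_pos (inv_pos.2 hτ.1), eq_inv_smul_iff₀ hτ.1.ne'] at e2
    rw [← e2, ← integral_smul]
    congr 1
    ext s
    have hτ' : (τ : ℂ) ≠ 0 := by exact_mod_cast hτ.1.ne'
    have p1 : (((τ * s + w.re : ℝ) : ℂ) + (w.im - τ : ℝ) * Complex.I) =
        w + (τ * s : ℝ) - τ * Complex.I := by
      conv_rhs => rw [← Complex.re_add_im w]
      push_cast; ring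
    have hs1 : (s : ℂ) - Complex.I ≠ 0 := fun h0 => by simpa using congrArg Complex.im h0
    have hs2 : (s : ℂ) + Complex.I ≠ 0 := fun h0 => by simpa using congrArg Complex.im h0
    have hs3 : ((1 + s ^ 2 : ℝ) : ℂ) = (s - Complex.I) * (s + Complex.I) := by
      push_cast; linear_combination Complex.I_sq
    have q1 : w + (τ * s : ℝ) - τ * Complex.I - w = τ * (s - Complex.I) := by push_cast; ring
    have q2 : w + (τ * s : ℝ) - τ * Complex.I - (w - 2 * τ * Complex.I) = τ * (s + Complex.I) := by
      push_cast; ring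
    rw [p1, q1, q2, hs3, Complex.real_smul]
    field_simp
    ring
  -- For `τ < w.im / 2` all arguments of `g` have imaginary part above `w.im / 2`, where `g` is
  -- bounded; this gives the dominating function.
  have hlim : Tendsto (fun τ : ℝ => ∫ s : ℝ,
      g (w + (τ * s : ℝ) - τ * Complex.I) * (2 * Complex.I * ((1 + s ^ 2 : ℝ) : ℂ)⁻¹))
      (𝓝[>] 0) (𝓝 (∫ s : ℝ, g w * (2 * Complex.I * ((1 + s ^ 2 : ℝ) : ℂ)⁻¹))) := by
    obtain ⟨C, hC⟩ := exists_norm_le_of_le_im hg hM hb (half_pos hw0)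
    have hev : ∀ᶠ τ : ℝ in 𝓝[>] 0, τ ∈ Set.Ioo 0 (w.im / 2) := Ioo_mem_nhdsGT (half_pos hw0)
    refine tendsto_integral_filter_of_dominated_convergence
      (fun s => C * 2 * (1 + s ^ 2)⁻¹) ?_ ?_ (integrable_inv_one_add_sq.const_mul _) ?_
    · filter_upwards [hev] with τ hτ
      refine (Continuous.mul ?_ ?_).aestronglyMeasurable
      · exact hg.continuousOn.comp_continuous (by fun_prop) fun s => by
          simp; linarith [hτ.2]
      · refine continuous_const.mul (Continuous.inv₀ (by fun_prop) fun s => ?_)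
        exact_mod_cast (by positivity : (0 : ℝ) < 1 + s ^ 2).ne'
    · filter_upwards [hev] with τ hτ
      refine Eventually.of_forall fun s => ?_
      rw [norm_mul, norm_mul, norm_mul, norm_inv, Complex.norm_real, Real.norm_of_nonneg (by positivity)]
      have := hC (w + (τ * s : ℝ) - τ * Complex.I) (by simp; linarith [hτ.2])
      have h2 : 0 ≤ (1 + s ^ 2)⁻¹ := by positivity
      simp only [Complex.norm_I, Complex.norm_ofNat, mul_one, ← mul_assoc]
      gcongr
    · refine Eventually.of_forall fun s => Tendsto.mul_const _ ?_
      have h1 := (hg.continuousOn.continuousAt (isOpen_halfPlane.mem_nhds hw0)).tendsto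
      refine h1.comp ?_
      have h2 : Continuous fun τ : ℝ => w + (τ * s : ℝ) - τ * Complex.I := by fun_prop
      simpa using (h2.tendsto 0).mono_left nhdsWithin_le_nhds
  have hval : A η = ∫ s : ℝ, g w * (2 * Complex.I * ((1 + s ^ 2 : ℝ) : ℂ)⁻¹) := by
    refine tendsto_nhds_unique (tendsto_const_nhds.congr' ?_) hlim
    filter_upwards [Ioo_mem_nhdsGT hw0] with τ hτ using hpoisson τ hτ
  rw [integral_const_mul, integral_const_mul] at hval
  simp_rw [← Complex.ofReal_inv] at hval
  rw [integral_complex_ofReal, integral_univ_inv_one_add_sq] at hval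
  have hpi : (Real.pi : ℂ) ≠ 0 := by exact_mod_cast Real.pi_ne_zero
  calc ∫ x : ℝ, g (x + η * Complex.I) * (2 * Real.pi * Complex.I * (x + η * Complex.I - w))⁻¹
      = ∫ x : ℝ, (2 * Real.pi * Complex.I)⁻¹ *
          (g (x + η * Complex.I) * ((x : ℂ) + η * Complex.I - w)⁻¹) := by
        congr 1; ext x; rw [mul_inv]; ring
    _ = g w := by
        rw [integral_const_mul]
        change _ * A η = _
        rw [hval]
        field_simp

end HalfPlane

/-! ### The Cauchy formula in the tube, by induction on the dimension -/

theorem measurePreserving_fin_cons (n : ℕ) :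
    MeasurePreserving (fun p : ℝ × (Fin n → ℝ) => (Fin.cons p.1 p.2 : Fin (n + 1) → ℝ)) := by
  have h := (volume_preserving_piFinSuccAbove (fun _ : Fin (n + 1) => ℝ) 0).symm
  convert h using 1
  ext p k
  simp [MeasurableEquiv.piFinSuccAbove]

theorem measurableEmbedding_fin_cons (n : ℕ) :
    MeasurableEmbedding (fun p : ℝ × (Fin n → ℝ) => (Fin.cons p.1 p.2 : Fin (n + 1) → ℝ)) := by
  have h := (MeasurableEquiv.piFinSuccAbove (fun _ : Fin (n + 1) => ℝ) 0).symm.measurableEmbedding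
  convert h using 1
  ext p k
  simp [MeasurableEquiv.piFinSuccAbove]

theorem lintegral_fin_cons {n : ℕ} {f : (Fin (n + 1) → ℝ) → ℝ≥0∞} (hf : Measurable f) :
    ∫⁻ x, f x = ∫⁻ x : ℝ, ∫⁻ x' : Fin n → ℝ, f (Fin.cons x x') := by
  rw [← (measurePreserving_fin_cons n).lintegral_comp hf, Measure.volume_eq_prod,
    lintegral_prod (fun p : ℝ × (Fin n → ℝ) => f (Fin.cons p.1 p.2))
      (hf.comp (measurePreserving_fin_cons n).measurable).aemeasurable]

theorem integral_fin_cons {n : ℕ} {f : (Fin (n + 1) → ℝ) → ℂ} (hf : Integrable f) :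
    ∫ x, f x = ∫ x : ℝ, ∫ x' : Fin n → ℝ, f (Fin.cons x x') := by
  have hi := (measurePreserving_fin_cons n).integrable_comp_of_integrable hf
  rw [← (measurePreserving_fin_cons n).integral_comp (measurableEmbedding_fin_cons n),
    Measure.volume_eq_prod, integral_prod]
  exact hi

theorem lintegral_fin_prod : ∀ {n : ℕ} {f : Fin n → ℝ → ℝ≥0∞}, (∀ k, Measurable (f k)) →
    ∫⁻ x : Fin n → ℝ, ∏ k, f k (x k) = ∏ k, ∫⁻ x, f k x := by
  intro n
  induction n with
  | zero => intro f _; simp [volume_pi]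
  | succ n ih =>
    intro f hf
    have hm : Measurable fun x : Fin n → ℝ => ∏ k, f k.succ (x k) :=
      Finset.measurable_fun_prod _ fun k _ => (hf _).comp (measurable_pi_apply k)
    have hm' : Measurable fun x : Fin (n + 1) → ℝ => ∏ k, f k (x k) :=
      Finset.measurable_fun_prod _ fun k _ => (hf _).comp (measurable_pi_apply k)
    rw [lintegral_fin_cons hm',
      Fin.prod_univ_succ, ← ih (fun k => hf k.succ), ← lintegral_mul_const _ (hf 0)]
    refine lintegral_congr fun x => ?_
    simp only [Fin.prod_univ_succ, Fin.cons_zero, Fin.cons_succ]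
    rw [lintegral_const_mul _ hm]

theorem tubePoint_cons {n : ℕ} (x y : ℝ) (x' y' : Fin n → ℝ) :
    tubePoint (Fin.cons x x') (Fin.cons y y') =
      (Fin.cons ((x : ℂ) + y * Complex.I) (tubePoint x' y') : Fin (n + 1) → ℂ) := by
  ext k
  refine Fin.cases ?_ (fun k => ?_) k <;> simp [tubePoint]

theorem cons_mem_tube {n : ℕ} {z : ℂ} {z' : Fin n → ℂ} (hz : 0 < z.im) (hz' : z' ∈ tube n) :
    (Fin.cons z z' : Fin (n + 1) → ℂ) ∈ tube (n + 1) := by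
  intro k
  refine Fin.cases ?_ (fun k => ?_) k
  · simpa using hz
  · simpa using hz' k

theorem cons_mem_octant {n : ℕ} {y : ℝ} {y' : Fin n → ℝ} (hy : 0 < y) (hy' : y' ∈ octant n) :
    (Fin.cons y y' : Fin (n + 1) → ℝ) ∈ octant (n + 1) := by
  intro k
  refine Fin.cases ?_ (fun k => ?_) k
  · simpa using hy
  · simpa using hy' k

theorem differentiable_fin_cons {n : ℕ} :
    Differentiable ℂ fun p : ℂ × (Fin n → ℂ) => (Fin.cons p.1 p.2 : Fin (n + 1) → ℂ) := by
  rw [differentiable_pi]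
  intro k
  refine Fin.cases ?_ (fun k => ?_) k
  · simp
  · simp only [Fin.cons_succ]
    fun_prop

theorem MemHardy.differentiableOn_cons_left {n : ℕ} {F : (Fin (n + 1) → ℂ) → ℂ} (hF : MemHardy F)
    {w : Fin n → ℂ} (hw : w ∈ tube n) :
    DifferentiableOn ℂ (fun z => F (Fin.cons z w)) {z | 0 < z.im} :=
  hF.1.comp (differentiable_fin_cons.comp (differentiable_id.prodMk
    (differentiable_const w))).differentiableOn fun _ hz => cons_mem_tube hz hw

/-- Fixing the first variable of a function in the Hardy space gives a function in the Hardy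
space. -/
theorem MemHardy.slice_cons {n : ℕ} {F : (Fin (n + 1) → ℂ) → ℂ} (hF : MemHardy F) {z : ℂ}
    (hz : 0 < z.im) : MemHardy fun z' : Fin n → ℂ => F (Fin.cons z z') := by
  classical
  refine ⟨hF.1.comp (differentiable_fin_cons.comp ((differentiable_const z).prodMk
    differentiable_id)).differentiableOn fun _ hz' => cons_mem_tube hz hz', ?_⟩
  have hmt : MeasurableSet (tube (n + 1)) := (isOpen_tube _).measurableSet
  -- Extension by zero off the tube makes the integrand Borel on the whole space, as Tonelli
  -- requires.
  set φ : (Fin (n + 1) → ℂ) → ℝ≥0∞ := fun w => ‖(tube (n + 1)).piecewise F 0 w‖ₑ ^ 2 with hφ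
  have hφm : Measurable φ :=
    (hF.1.continuousOn.measurable_piecewise continuousOn_const hmt).enorm.pow_const 2
  have hφe : ∀ w ∈ tube (n + 1), φ w = ‖F w‖ₑ ^ 2 := fun w hw => by
    rw [hφ]; simp only [Set.piecewise_eq_of_mem _ _ _ hw]
  have hpos : 0 < Real.pi * z.im ^ 2 := by have := Real.pi_pos; positivity
  have hcm : Measurable fun p : ℂ × (Fin n → ℂ) => (Fin.cons p.1 p.2 : Fin (n + 1) → ℂ) :=
    differentiable_fin_cons.continuous.measurable
  have hbound : ∀ y ∈ octant n, ∫⁻ x, ‖F (Fin.cons z (tubePoint x y))‖ₑ ^ 2 ≤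
      hardyNormSq F * ENNReal.ofReal (2 * z.im) / ENNReal.ofReal (Real.pi * z.im ^ 2) := by
    intro y hy
    rw [ENNReal.le_div_iff_mul_le (Or.inl (by simpa using hpos)) (Or.inl ENNReal.ofReal_ne_top),
      ← lintegral_mul_const' _ _ ENNReal.ofReal_ne_top]
    -- Mean value inequality in the first variable on the disc of radius `z.im`, enlarged to the
    -- strip `0 < t < 2 * z.im`. After integration over `x`, each height `t` contributes one full
    -- slice norm.
    have hpt : ∀ x, ‖F (Fin.cons z (tubePoint x y))‖ₑ ^ 2 * ENNReal.ofReal (Real.pi * z.im ^ 2) ≤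
        ∫⁻ t in Set.Ioo 0 (2 * z.im), ∫⁻ s : ℝ, φ (Fin.cons (s + t * Complex.I) (tubePoint x y)) := by
      intro x
      have hball : ∀ w ∈ Metric.ball z z.im, 0 < w.im := by
        intro w hw
        have h2 := (Complex.abs_im_le_norm (w - z)).trans_lt (by simpa [dist_eq_norm] using hw)
        rw [Complex.sub_im, abs_lt] at h2
        linarith
      have h1 := enorm_sq_le_lintegral_ball (g := fun w => F (Fin.cons w (tubePoint x y))) hz
        ((hF.differentiableOn_cons_left (tubePoint_mem x hy)).mono hball)
      rw [mul_comm]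
      refine h1.trans ?_
      rw [setLIntegral_congr_fun (g := fun w => φ (Fin.cons w (tubePoint x y))) measurableSet_ball
        (fun w hw => (hφe _ (cons_mem_tube (hball w hw) (tubePoint_mem x hy))).symm)]
      refine (lintegral_ball_le (Measurable.aemeasurable ?_)).trans_eq ?_
      · exact hφm.comp (hcm.comp (measurable_id.prodMk measurable_const))
      · rw [sub_self, ← two_mul]
    refine (lintegral_mono hpt).trans ?_
    have hjm : Measurable fun q : ((Fin n → ℝ) × ℝ) × ℝ =>
        φ (Fin.cons ((q.2 : ℂ) + q.1.2 * Complex.I) (tubePoint q.1.1 y)) := by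
      refine hφm.comp (hcm.comp (Measurable.prodMk (by fun_prop) ?_))
      fun_prop
    rw [lintegral_lintegral_swap (Measurable.lintegral_prod_right' hjm).aemeasurable]
    calc ∫⁻ t in Set.Ioo 0 (2 * z.im), ∫⁻ x : Fin n → ℝ, ∫⁻ s : ℝ,
          φ (Fin.cons (s + t * Complex.I) (tubePoint x y))
        ≤ ∫⁻ t in Set.Ioo 0 (2 * z.im), hardyNormSq F := by
          refine setLIntegral_mono' measurableSet_Ioo fun t ht => ?_
          have hyt : (Fin.cons t y : Fin (n + 1) → ℝ) ∈ octant (n + 1) := cons_mem_octant ht.1 hy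
          refine le_trans (le_of_eq ?_) (lintegral_slice_le F hyt)
          rw [lintegral_congr fun x => (hφe _ (tubePoint_mem x hyt)).symm, lintegral_fin_cons,
            lintegral_lintegral_swap]
          · simp only [tubePoint_cons]
          · exact (hjm.comp (by fun_prop : Measurable
              fun p : (Fin n → ℝ) × ℝ => ((p.1, t), p.2))).aemeasurable
          · refine hφm.comp ?_
            unfold tubePoint
            fun_prop
      _ = _ := by rw [setLIntegral_const, Real.volume_Ioo, sub_zero]
  refine (iSup₂_le hbound).trans_lt ?_
  exact ENNReal.div_lt_top (ENNReal.mul_ne_top hF.2.ne ENNReal.ofReal_ne_top) (by simpa using hpos)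

theorem enorm_prod {ι : Type*} (s : Finset ι) (f : ι → ℂ) : ‖∏ i ∈ s, f i‖ₑ = ∏ i ∈ s, ‖f i‖ₑ := by
  classical
  induction s using Finset.induction_on with
  | empty => simp
  | insert a s ha ih => rw [Finset.prod_insert ha, Finset.prod_insert ha, enorm_mul, ih]

/-- `L²` bound for a product of Cauchy kernels along a horizontal slice. -/
theorem lintegral_enorm_prod_inv_sub_sq_le {n : ℕ} {p : Fin n → ℂ} {y v : Fin n → ℝ}
    (hv : ∀ k, 0 < v k) (hy : ∀ k, v k ≤ |y k - (p k).im|) :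
    ∫⁻ x, ‖∏ k, (tubePoint x y k - p k)⁻¹‖ₑ ^ 2 ≤ ∏ k, ENNReal.ofReal (Real.pi / v k) := by
  calc ∫⁻ x, ‖∏ k, (tubePoint x y k - p k)⁻¹‖ₑ ^ 2
      = ∫⁻ x : Fin n → ℝ, ∏ k, ‖((x k : ℂ) + y k * Complex.I - p k)⁻¹‖ₑ ^ 2 := by
        simp only [enorm_prod, Finset.prod_pow, tubePoint]
    _ = ∏ k, ∫⁻ x : ℝ, ‖((x : ℂ) + y k * Complex.I - p k)⁻¹‖ₑ ^ 2 :=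
        lintegral_fin_prod (f := fun k x => ‖((x : ℂ) + y k * Complex.I - p k)⁻¹‖ₑ ^ 2)
          fun k => by fun_prop
    _ ≤ _ := Finset.prod_le_prod' fun k _ => lintegral_enorm_inv_sub_sq_le (hv k) (hy k)

theorem integrable_mul_of_lintegral_sq {X : Type*} [MeasurableSpace X] {μ : Measure X}
    {f g : X → ℂ} (hf : AEStronglyMeasurable f μ) (hg : AEStronglyMeasurable g μ)
    (hf' : ∫⁻ x, ‖f x‖ₑ ^ 2 ∂μ < ∞) (hg' : ∫⁻ x, ‖g x‖ₑ ^ 2 ∂μ < ∞) :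
    Integrable (fun x => f x * g x) μ := by
  refine ⟨hf.mul hg, ?_⟩
  rw [hasFiniteIntegral_iff_enorm]
  have h2 := (lintegral_enorm_mul_sq_le hf hg).trans_lt (ENNReal.mul_lt_top hf' hg')
  by_contra h'
  rw [not_lt, top_le_iff] at h'
  rw [h'] at h2
  simp at h2

/-- The Cauchy formula for functions in the Hardy space of the tube. -/
theorem cauchy_formula_tube : ∀ {n : ℕ} {F : (Fin n → ℂ) → ℂ}, MemHardy F → ∀ {η : Fin n → ℝ},
    η ∈ octant n → ∀ {w : Fin n → ℂ}, (∀ k, η k < (w k).im) →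
    ∫ x, F (tubePoint x η) * ∏ k, (2 * Real.pi * Complex.I * (tubePoint x η k - w k))⁻¹ = F w := by
  intro n
  induction n with
  | zero =>
    intro F _ η _ w _
    have h : ∀ x, tubePoint x η = w := fun x => Subsingleton.elim _ _
    simp [h, volume_pi, Measure.real, Measure.pi_empty_univ]
  | succ n ih =>
    intro F hF η hη w hw
    obtain ⟨η₁, η', rfl⟩ : ∃ a b, η = Fin.cons a b := ⟨η 0, Fin.tail η, (Fin.cons_self_tail η).symm⟩
    obtain ⟨w₁, w', rfl⟩ : ∃ a b, w = Fin.cons a b := ⟨w 0, Fin.tail w, (Fin.cons_self_tail w).symm⟩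
    have hη₁ : 0 < η₁ := by simpa using hη 0
    have hη' : η' ∈ octant n := fun k => by simpa using hη k.succ
    have hw₁ : η₁ < w₁.im := by simpa using hw 0
    have hw' : ∀ k, η' k < (w' k).im := fun k => by simpa using hw k.succ
    have hwt : w' ∈ tube n := fun k => (hη' k).trans (hw' k)
    have hker : ∀ {m : ℕ} (p : Fin m → ℂ) (y : Fin m → ℝ), (∀ k, y k < (p k).im) →
        Continuous (fun x => ∏ k, (2 * Real.pi * Complex.I * (tubePoint x y k - p k))⁻¹) ∧
        ∫⁻ x, ‖∏ k, (2 * Real.pi * Complex.I * (tubePoint x y k - p k))⁻¹‖ₑ ^ 2 < ∞ := by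
      intro m p y hp
      constructor
      · refine continuous_finsetProd _ fun k _ => Continuous.inv₀ ?_ fun x h0 => ?_
        · unfold tubePoint
          fun_prop
        · have h1 : tubePoint x y k - p k = 0 := by
            simpa [Real.pi_ne_zero, Complex.I_ne_zero] using h0
          have := congrArg Complex.im h1
          simp [tubePoint] at this
          linarith [hp k]
      · simp only [mul_inv (2 * Real.pi * Complex.I), Finset.prod_mul_distrib, enorm_mul, mul_pow]
        rw [lintegral_const_mul' _ _ (ENNReal.pow_ne_top enorm_ne_top)]
        refine ENNReal.mul_lt_top (ENNReal.pow_lt_top enorm_lt_top) ((lintegral_enorm_prod_inv_sub_sq_le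
          (v := fun k => (p k).im - y k) (fun k => sub_pos.2 (hp k)) fun k => ?_).trans_lt
            (ENNReal.prod_lt_top fun k _ => ENNReal.ofReal_lt_top))
        rw [abs_sub_comm]
        exact le_abs_self _
    have hslice : ∀ z : ℂ, 0 < z.im → F (Fin.cons z w') = ∫ x, F (Fin.cons z (tubePoint x η')) *
        ∏ k, (2 * Real.pi * Complex.I * (tubePoint x η' k - w' k))⁻¹ :=
      fun z hz => (ih (hF.slice_cons hz) hη' hw').symm
    obtain ⟨hkc, hkf⟩ := hker w' η' hw'
    -- The half-plane formula needs $L^2$ bounds in the first variable at fixed `w'`. They follow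
    -- from Cauchy–Schwarz in the formula for the remaining variables.
    have hb : ∀ y : ℝ, 0 < y → ∫⁻ x : ℝ, ‖F (Fin.cons (x + y * Complex.I) w')‖ₑ ^ 2 ≤
        hardyNormSq F *
          ∫⁻ x, ‖∏ k, (2 * Real.pi * Complex.I * (tubePoint x η' k - w' k))⁻¹‖ₑ ^ 2 := by
      intro y hy
      have h1 : ∀ x : ℝ, ‖F (Fin.cons (x + y * Complex.I) w')‖ₑ ^ 2 ≤
          (∫⁻ x' : Fin n → ℝ, ‖F (Fin.cons (x + y * Complex.I) (tubePoint x' η'))‖ₑ ^ 2) *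
          ∫⁻ x, ‖∏ k, (2 * Real.pi * Complex.I * (tubePoint x η' k - w' k))⁻¹‖ₑ ^ 2 := by
        intro x
        have hz : 0 < ((x : ℂ) + y * Complex.I).im := by simpa using hy
        rw [hslice _ hz]
        exact (pow_le_pow_left' (enorm_integral_le_lintegral_enorm _) 2).trans
          (lintegral_enorm_mul_sq_le ((hF.slice_cons hz).continuous_slice hη').aestronglyMeasurable
            hkc.aestronglyMeasurable)
      refine (lintegral_mono h1).trans ?_
      rw [lintegral_mul_const' _ _ hkf.ne]
      gcongr
      have hyη := cons_mem_octant hy hη'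
      refine le_trans (le_of_eq ?_) (lintegral_slice_le F hyη)
      rw [lintegral_fin_cons ((hF.continuous_slice hyη).measurable.enorm.pow_const 2)]
      simp only [tubePoint_cons]
    have hcf := cauchy_formula_halfPlane (g := fun z => F (Fin.cons z w'))
      (hF.differentiableOn_cons_left hwt) (ENNReal.mul_ne_top hF.2.ne hkf.ne) hb hη₁ hw₁
    rw [← hcf]
    obtain ⟨hKc, hKf⟩ := hker (Fin.cons w₁ w' : Fin (n + 1) → ℂ) (Fin.cons η₁ η') hw
    rw [integral_fin_cons (integrable_mul_of_lintegral_sq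
      (hF.continuous_slice hη).aestronglyMeasurable hKc.aestronglyMeasurable
      ((lintegral_slice_le F hη).trans_lt hF.2) hKf)]
    refine integral_congr_ae (Eventually.of_forall fun x => ?_)
    simp only
    rw [hslice _ (by simpa using hη₁), ← integral_mul_const]
    refine integral_congr_ae (Eventually.of_forall fun x' => ?_)
    simp only [tubePoint_cons, Fin.prod_univ_succ, Fin.cons_zero, Fin.cons_succ]
    ring

/-! ### The reproducing kernel -/

/-- The monomials `∏ₖ (wₖ - conj zₖ)^(-(αₖ + 1))`, multiples of the derivatives of the
Cauchy–Szegő kernel. -/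
noncomputable def kernelMonomial {n : ℕ} (α : Fin n → ℕ) (z w : Fin n → ℂ) : ℂ :=
  ∏ k, ((w k - conj (z k))⁻¹) ^ (α k + 1)

theorem sub_conj_ne_zero {a b : ℂ} (ha : 0 < a.im) (hb : 0 < b.im) : a - conj b ≠ 0 := fun h => by
  have := congrArg Complex.im h
  simp at this
  linarith

/-- Since $|w_k-\overline{z_k}|\ge\operatorname{Im}z_k$, all but one power of each factor is
bounded, and the simple Cauchy kernels left over have slice norms bounded uniformly in the height.
-/
theorem memHardy_kernelMonomial {n : ℕ} (α : Fin n → ℕ) {z : Fin n → ℂ} (hz : z ∈ tube n) :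
    MemHardy (kernelMonomial α z) := by
  constructor
  · intro w hw
    refine DifferentiableAt.differentiableWithinAt ?_
    have h : ∀ k, DifferentiableAt ℂ (fun w : Fin n → ℂ => ((w k - conj (z k))⁻¹) ^ (α k + 1)) w :=
      fun k => by
        have h1 : DifferentiableAt ℂ (fun w : Fin n → ℂ => w k - conj (z k)) w := by fun_prop
        exact (h1.inv (sub_conj_ne_zero (hw k) (hz k))).pow _
    unfold kernelMonomial
    fun_prop (disch := exact h _)
  · set C : ℝ≥0∞ := ∏ k, (ENNReal.ofReal ((z k).im⁻¹ ^ α k)) ^ 2 with hC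
    have hCt : C ≠ ∞ := ENNReal.prod_ne_top fun k _ => ENNReal.pow_ne_top ENNReal.ofReal_ne_top
    have hpt : ∀ w ∈ tube n, ‖kernelMonomial α z w‖ₑ ^ 2 ≤
        C * ‖∏ k, (w k - conj (z k))⁻¹‖ₑ ^ 2 := by
      intro w hw
      rw [kernelMonomial, enorm_prod, enorm_prod, hC, Finset.prod_pow, ← mul_pow,
        ← Finset.prod_mul_distrib]
      gcongr with k _
      rw [pow_succ, enorm_mul]
      gcongr
      rw [← ofReal_norm, norm_pow]
      refine ENNReal.ofReal_le_ofReal ?_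
      rw [norm_inv]
      have hzk : 0 < (z k).im := hz k
      gcongr
      have h1 := Complex.abs_im_le_norm (w k - conj (z k))
      have h2 := le_abs_self (w k - conj (z k)).im
      have h3 : 0 < (w k).im := hw k
      simp only [Complex.sub_im, Complex.conj_im, sub_neg_eq_add] at h1 h2
      linarith
    refine (iSup₂_le (a := C * ∏ k, ENNReal.ofReal (Real.pi / (z k).im)) fun y hy => ?_).trans_lt
      (ENNReal.mul_lt_top hCt.lt_top (ENNReal.prod_lt_top fun k _ => ENNReal.ofReal_lt_top))
    refine (lintegral_mono fun x => hpt _ (tubePoint_mem x hy)).trans ?_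
    rw [lintegral_const_mul' _ _ hCt]
    gcongr
    refine lintegral_enorm_prod_inv_sub_sq_le (p := fun k => conj (z k)) (v := fun k => (z k).im)
      hz fun k => ?_
    refine le_trans ?_ (le_abs_self _)
    have : 0 < y k := hy k
    simp only [Complex.conj_im]
    linarith

theorem MemHardy.congr {n : ℕ} {F G : (Fin n → ℂ) → ℂ} (hF : MemHardy F)
    (h : Set.EqOn G F (tube n)) : MemHardy G := by
  refine ⟨hF.1.congr h, lt_of_eq_of_lt ?_ hF.2⟩
  refine biSup_congr fun y hy => lintegral_congr fun x => ?_
  rw [h (tubePoint_mem x hy)]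

theorem szegoKernel_eq {n : ℕ} (w z : Fin n → ℂ) :
    szegoKernel w z = ((-1) / (2 * Real.pi * Complex.I)) ^ n * kernelMonomial 0 z w := by
  simp only [szegoKernel, kernelMonomial, Pi.zero_apply, zero_add, pow_one]
  have h : ((-1 : ℂ) / (2 * Real.pi * Complex.I)) ^ n =
      ∏ _k : Fin n, (-1 : ℂ) / (2 * Real.pi * Complex.I) := by
    rw [Finset.prod_const, Finset.card_fin]
  rw [h, ← Finset.prod_mul_distrib]
  refine Finset.prod_congr rfl fun k _ => ?_
  rw [div_mul_eq_div_div]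
  rfl

theorem memHardy_szegoKernel {n : ℕ} {z : Fin n → ℂ} (hz : z ∈ tube n) :
    MemHardy fun w => szegoKernel w z := by
  simp_rw [szegoKernel_eq]
  exact (hardySpace n).smul_mem _ (memHardy_kernelMonomial 0 hz)

/-- The Cauchy–Szegő kernel is the reproducing kernel of the Hardy space. -/
theorem inner_boundaryValue_szegoKernel {n : ℕ} (F : hardySpace n) {z : Fin n → ℂ}
    (hz : z ∈ tube n) :
    inner ℂ (boundaryValue n ⟨fun w => szegoKernel w z, memHardy_szegoKernel hz⟩)
      (boundaryValue n F) = F.1 z := by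
  have := nhdsWithin_octant_neBot n
  have hK := memHardy_szegoKernel hz
  have h1 := (tendsto_hardySlice ⟨fun w => szegoKernel w z, hK⟩).inner (𝕜 := ℂ) (tendsto_hardySlice F)
  refine tendsto_nhds_unique h1 ?_
  have hF : MemHardy F.1 := F.2
  -- On the slice at height `η` the conjugated kernel is the Cauchy kernel with pole $z+2i\eta$,
  -- because $x-i\eta-z=(x+i\eta)-(z+2i\eta)$. The pairing of slices is thus $F(z+2i\eta)$, which
  -- tends to $F(z)$.
  have h2 : Continuous fun η : Fin n → ℝ => z + tubePoint 0 (2 • η) := by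
    unfold tubePoint
    fun_prop
  have h3 : Tendsto (fun η : Fin n → ℝ => F.1 (z + tubePoint 0 (2 • η))) (𝓝[octant n] 0)
      (𝓝 (F.1 z)) := by
    have h4 := (hF.1.continuousOn.continuousAt ((isOpen_tube n).mem_nhds hz)).tendsto
    refine h4.comp (Tendsto.mono_left ?_ nhdsWithin_le_nhds)
    have h5 : z + tubePoint 0 (2 • (0 : Fin n → ℝ)) = z := by ext k; simp [tubePoint]
    simpa only [h5] using h2.tendsto 0
  refine h3.congr' ?_
  filter_upwards [eventually_mem_nhdsWithin] with η hη
  rw [inner_hardySlice hF hK hη hη,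
    ← cauchy_formula_tube hF hη (w := z + tubePoint 0 (2 • η)) fun k => by
      have h6 : 0 < (z k).im := hz k
      have h7 : 0 < η k := hη k
      simp [tubePoint]
      linarith]
  refine integral_congr_ae (Eventually.of_forall fun x => ?_)
  simp only [szegoKernel, map_prod, map_div₀, map_mul, map_neg, map_one, map_sub, Complex.conj_conj,
    Complex.conj_I, Complex.conj_ofReal, Complex.conj_ofNat]
  congr 1
  refine Finset.prod_congr rfl fun k _ => ?_
  have h8 : conj (tubePoint x η k) - z k = tubePoint x η k - (z + tubePoint 0 (2 • η) : Fin n → ℂ) k := by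
    simp [tubePoint]
    ring
  rw [h8, neg_div, ← div_neg, one_div]
  congr 1
  ring

/-- A function of the Hardy space is determined on the tube by its boundary values. -/
theorem eqOn_zero_of_boundaryValue_eq_zero {n : ℕ} (F : hardySpace n)
    (h : boundaryValue n F = 0) : Set.EqOn F.1 0 (tube n) := fun z hz => by
  rw [← inner_boundaryValue_szegoKernel F hz, h, inner_zero_right, Pi.zero_apply]

/-! ### Derivatives of the kernel in its parameter -/

theorem hasLineDerivAt_kernelMonomial {n : ℕ} (α : Fin n → ℕ) {z w : Fin n → ℂ} (hz : z ∈ tube n)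
    (hw : w ∈ tube n) (l : Fin n → ℂ) :
    HasLineDerivAt ℝ (fun ζ => kernelMonomial α ζ w)
      (∑ k, ((α k + 1 : ℕ) * conj (l k)) * kernelMonomial (α + Pi.single k 1) z w) z l := by
  have hfac : ∀ k, HasDerivAt
      (fun t : ℝ => ((w k - conj ((z + t • l) k))⁻¹) ^ (α k + 1))
      ((α k + 1 : ℕ) * ((w k - conj (z k))⁻¹) ^ (α k) *
        (conj (l k) * ((w k - conj (z k))⁻¹) ^ 2)) 0 := by
    intro k
    have h1 : HasDerivAt (fun t : ℝ => w k - conj ((z + t • l) k)) (-conj (l k)) 0 := by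
      have h2 : HasDerivAt (fun t : ℝ => w k - (conj (z k) + (t : ℂ) * conj (l k)))
          (-(1 * conj (l k))) 0 :=
        (((Complex.ofRealCLM.hasDerivAt (x := (0 : ℝ))).mul_const (conj (l k))).const_add
          (conj (z k))).const_sub (w k)
      simpa using h2
    have h0 : w k - conj ((z + (0 : ℝ) • l) k) ≠ 0 := by
      simpa using sub_conj_ne_zero (hw k) (hz k)
    have h3 := (h1.inv h0).pow (α k + 1)
    refine h3.congr_deriv ?_
    have h5 : (z + (0 : ℝ) • l) k = z k := by simp
    simp only [Pi.inv_apply, h5, Nat.add_sub_cancel, neg_neg, div_eq_mul_inv, inv_pow]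
  have hprod := HasDerivAt.fun_finsetProd (u := Finset.univ) fun k _ => hfac k
  unfold HasLineDerivAt kernelMonomial
  refine hprod.congr_deriv (Eq.symm ?_)
  refine Finset.sum_congr rfl fun k _ => ?_
  rw [← Finset.mul_prod_erase Finset.univ _ (Finset.mem_univ k), smul_eq_mul]
  have h4 : ∏ j ∈ Finset.univ.erase k, ((w j - conj (z j))⁻¹) ^ ((α + Pi.single k 1 : Fin n → ℕ) j + 1) =
      ∏ j ∈ Finset.univ.erase k, ((w j - conj ((z + (0 : ℝ) • l) j))⁻¹) ^ (α j + 1) := by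
    refine Finset.prod_congr rfl fun j hj => ?_
    simp [Pi.single_eq_of_ne (Finset.ne_of_mem_erase hj)]
  rw [h4]
  simp only [Pi.add_apply, Pi.single_eq_same]
  ring

/-- The span of the kernel monomials, as functions of both variables. -/
noncomputable def kernelMonomialSpan (n : ℕ) : Submodule ℂ ((Fin n → ℂ) → (Fin n → ℂ) → ℂ) :=
  Submodule.span ℂ (Set.range kernelMonomial)

/-- A directional derivative of a monomial only raises exponents by one, with coefficients depending
on `l` alone. The span is therefore stable, and iterated derivatives never leave it. -/
theorem exists_hasLineDerivAt_of_mem_span {n : ℕ} {G : (Fin n → ℂ) → (Fin n → ℂ) → ℂ}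
    (hG : G ∈ kernelMonomialSpan n) (l : Fin n → ℂ) :
    ∃ G' ∈ kernelMonomialSpan n, ∀ z ∈ tube n, ∀ w ∈ tube n,
      HasLineDerivAt ℝ (fun ζ => G ζ w) (G' z w) z l := by
  induction hG using Submodule.span_induction with
  | mem G h =>
    obtain ⟨α, rfl⟩ := h
    refine ⟨∑ k, ((α k + 1 : ℕ) * conj (l k)) • kernelMonomial (α + Pi.single k 1),
      Submodule.sum_mem _ fun k _ => Submodule.smul_mem _ _ (Submodule.subset_span ⟨_, rfl⟩),
      fun z hz w hw => ?_⟩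
    simpa [Finset.sum_apply] using hasLineDerivAt_kernelMonomial α hz hw l
  | zero => exact ⟨0, Submodule.zero_mem _, fun z _ w _ => hasDerivAt_const _ _⟩
  | add G₁ G₂ _ _ h₁ h₂ =>
    obtain ⟨G₁', hm₁, h₁⟩ := h₁
    obtain ⟨G₂', hm₂, h₂⟩ := h₂
    exact ⟨G₁' + G₂', Submodule.add_mem _ hm₁ hm₂, fun z hz w hw =>
      HasDerivAt.add (h₁ z hz w hw) (h₂ z hz w hw)⟩
  | smul c G _ h =>
    obtain ⟨G', hm, h⟩ := h
    exact ⟨c • G', Submodule.smul_mem _ _ hm, fun z hz w hw => HasDerivAt.const_smul c (h z hz w hw)⟩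

theorem exists_mem_span_of_mem_kernelDerivatives {n : ℕ} : ∀ {h : ℕ}
    {Ψ : (Fin n → ℂ) → (Fin n → ℂ) → ℂ}, Ψ ∈ kernelDerivatives n h →
    ∃ G ∈ kernelMonomialSpan n, ∀ z ∈ tube n, ∀ w ∈ tube n, Ψ z w = G z w := by
  intro h
  induction h with
  | zero =>
    intro Ψ hΨ
    rw [kernelDerivatives, Set.mem_singleton_iff] at hΨ
    refine ⟨((-1) / (2 * Real.pi * Complex.I)) ^ n • kernelMonomial 0,
      Submodule.smul_mem _ _ (Submodule.subset_span ⟨_, rfl⟩), fun z _ w _ => ?_⟩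
    rw [hΨ]
    exact szegoKernel_eq w z
  | succ h ih =>
    rintro Ψ ⟨Ψ', hΨ', l, rfl⟩
    obtain ⟨G, hG, hGe⟩ := ih hΨ'
    obtain ⟨G', hG', hGd⟩ := exists_hasLineDerivAt_of_mem_span hG l
    refine ⟨G', hG', fun z hz w hw => ?_⟩
    -- Agreement is known only on the tube; openness of the tube makes it enough for the derivative.
    have he : (fun ζ => Ψ' ζ w) =ᶠ[𝓝 z] fun ζ => G ζ w := by
      filter_upwards [(isOpen_tube n).mem_nhds hz] with ζ hζ using hGe ζ hζ w hw
    exact ((hGd z hz w hw).congr_of_eventuallyEq he).lineDeriv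

/-! ### Linear independence of kernel elements -/

/-- With `y` frozen, a vanishing combination is one of the `u i` with coefficients $\sum_j
c_{ij}v_j(y)$. These vanish for every `y`, and independence of `v` finishes. -/
theorem linearIndependent_mul {K ι κ X Y : Type*} [Field K] {u : ι → X → K} {v : κ → Y → K}
    (hu : LinearIndependent K u) (hv : LinearIndependent K v) :
    LinearIndependent K fun (i : ι × κ) (p : X × Y) => u i.1 p.1 * v i.2 p.2 := by
  rw [linearIndependent_iff] at hu hv ⊢
  intro c hc
  let ev : Y → (κ →₀ K) →ₗ[K] K := fun y => LinearMap.proj y ∘ₗ Finsupp.linearCombination K v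
  have key : ∀ (c : ι × κ →₀ K) (x : X) (y : Y),
      Finsupp.linearCombination K (fun (i : ι × κ) (p : X × Y) => u i.1 p.1 * v i.2 p.2) c (x, y) =
      Finsupp.linearCombination K u
        (Finsupp.mapRange.linearMap (ev y) (Finsupp.curryLinearEquiv K c)) x := by
    intro c x y
    induction c using Finsupp.induction_linear with
    | zero => simp only [map_zero, Pi.zero_apply]
    | add c d hc hd => simp only [map_add, Pi.add_apply, hc, hd]
    | single i a =>
      have h : Finsupp.curryLinearEquiv K (Finsupp.single i a) =
          Finsupp.single i.1 (Finsupp.single i.2 a) := Finsupp.curry_single _ _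
      rw [h, Finsupp.mapRange.linearMap_apply, Finsupp.mapRange_single]
      have h' : ev y (Finsupp.single i.2 a) = a * v i.2 y := by simp [ev]
      rw [h', Finsupp.linearCombination_single, Finsupp.linearCombination_single]
      simp only [Pi.smul_apply, smul_eq_mul]
      ring
  have h1 : ∀ y, Finsupp.mapRange.linearMap (ev y) (Finsupp.curryLinearEquiv K c) = 0 :=
    fun y => hu _ (funext fun x => by rw [← key, hc]; rfl)
  have h2 : ∀ i, c.curry i = 0 := fun i => hv _ (funext fun y => DFunLike.congr_fun (h1 y) i)
  ext ⟨i, j⟩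
  simpa using DFunLike.congr_fun (h2 i) j

theorem linearIndependent_prod_apply {K ι X : Type*} [Field K] {u : ι → X → K}
    (hu : LinearIndependent K u) : ∀ n : ℕ,
    LinearIndependent K fun (i : Fin n → ι) (x : Fin n → X) => ∏ k, u (i k) (x k) := by
  intro n
  induction n with
  | zero =>
    refine linearIndependent_unique_iff.2 fun h => ?_
    simpa using congrFun h default
  | succ n ih =>
    refine LinearIndependent.of_comp
      (LinearMap.funLeft K K fun p : X × (Fin n → X) => (Fin.cons p.1 p.2 : Fin (n + 1) → X)) ?_
    have h := (linearIndependent_mul hu ih).comp (fun i : Fin (n + 1) → ι => (i 0, Fin.tail i))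
      (fun i j h => by
        rw [Prod.mk.injEq] at h
        rw [← Fin.cons_self_tail i, ← Fin.cons_self_tail j, h.1, h.2])
    convert h using 1
    ext i p
    simp [LinearMap.funLeft_apply, Fin.prod_univ_succ, Fin.tail]

/-- Uniqueness of partial fractions: clear denominators with the highest power `N` occurring with
nonzero coefficient, and evaluate the resulting polynomial at a pole that attains it. -/
theorem linearIndependent_inv_pow :
    LinearIndependent ℂ fun (i : {a : ℂ // 0 < a.im} × ℕ) (x : {x : ℂ // 0 < x.im}) =>
      ((x.1 - conj i.1.1)⁻¹) ^ (i.2 + 1) := by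
  classical
  rw [linearIndependent_iff']
  intro s c hsum
  by_contra! hex
  set t := s.filter fun i => c i ≠ 0 with ht
  have hne : t.Nonempty := by
    obtain ⟨i, hi, hci⟩ := hex
    exact ⟨i, Finset.mem_filter.2 ⟨hi, hci⟩⟩
  obtain ⟨i₀, hi₀, hmax⟩ := t.exists_max_image Prod.snd hne
  set N := i₀.2 + 1 with hN
  set S := t.image Prod.fst with hS
  -- `T i` is the common denominator, with every pole to the power `N`, times the fraction of index
  -- `i`. The subtraction in the exponent does not truncate for `i ∈ t`.
  set T : {a : ℂ // 0 < a.im} × ℕ → Polynomial ℂ := fun i =>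
    ∏ b ∈ S, (Polynomial.X - Polynomial.C (conj b.1)) ^ (N - if b = i.1 then i.2 + 1 else 0) with hT
  have hle : ∀ i ∈ t, i.2 + 1 ≤ N := fun i hi => Nat.succ_le_succ (hmax i hi)
  have hTe : ∀ i ∈ t, ∀ x : {x : ℂ // 0 < x.im}, (T i).eval x.1 =
      (∏ b ∈ S, (x.1 - conj b.1) ^ N) * ((x.1 - conj i.1.1)⁻¹) ^ (i.2 + 1) := by
    intro i hi x
    have hiS : i.1 ∈ S := Finset.mem_image_of_mem _ hi
    rw [hT, Polynomial.eval_prod, ← Finset.mul_prod_erase S _ hiS,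
      ← Finset.mul_prod_erase S (fun b => (x.1 - conj b.1) ^ N) hiS, mul_right_comm]
    congr 1
    · simp only [if_true, Polynomial.eval_pow, Polynomial.eval_sub, Polynomial.eval_X,
        Polynomial.eval_C]
      rw [pow_sub₀ _ (sub_conj_ne_zero x.2 i.1.2) (hle i hi), inv_pow]
    · refine Finset.prod_congr rfl fun b hb => ?_
      simp [Finset.ne_of_mem_erase hb]
  have hP : ∑ i ∈ t, Polynomial.C (c i) * T i = 0 := by
    refine Polynomial.eq_zero_of_infinite_isRoot _ (Set.infinite_of_injective_forall_mem
      (f := fun k : ℕ => (k : ℂ) + Complex.I) (fun a b h => by simpa using h) fun k => ?_)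
    set x : {x : ℂ // 0 < x.im} := ⟨(k : ℂ) + Complex.I, by simp⟩ with hx
    change Polynomial.eval x.1 _ = 0
    rw [Polynomial.eval_finsetSum]
    have h1 := congrFun hsum x
    rw [Finset.sum_apply, Pi.zero_apply] at h1
    have h2 : ∑ i ∈ t, c i * ((x.1 - conj i.1.1)⁻¹) ^ (i.2 + 1) = 0 := by
      rw [ht, Finset.sum_filter_of_ne]
      · exact h1
      · intro i _ h h0
        simp [h0] at h
    calc _ = (∏ b ∈ S, (x.1 - conj b.1) ^ N) *
          ∑ i ∈ t, c i * ((x.1 - conj i.1.1)⁻¹) ^ (i.2 + 1) := by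
          rw [Finset.mul_sum]
          refine Finset.sum_congr rfl fun i hi => ?_
          rw [Polynomial.eval_mul, Polynomial.eval_C, hTe i hi x]
          ring
      _ = 0 := by rw [h2, mul_zero]
  -- At the pole of `i₀` every other term vanishes: it has either another pole, or the same pole
  -- with exponent below `N`.
  have h3 := congrArg (Polynomial.eval (conj i₀.1.1)) hP
  rw [Polynomial.eval_finsetSum, Finset.sum_eq_single i₀, Polynomial.eval_mul, Polynomial.eval_C,
    Polynomial.eval_zero] at h3
  · rcases mul_eq_zero.1 h3 with h | h
    · exact (Finset.mem_filter.1 hi₀).2 h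
    · rw [hT, Polynomial.eval_prod, Finset.prod_eq_zero_iff] at h
      obtain ⟨b, _, hb⟩ := h
      by_cases hbi : b = i₀.1
      · simp [hbi, hN] at hb
      · simp only [Polynomial.eval_pow, Polynomial.eval_sub, Polynomial.eval_X,
          Polynomial.eval_C] at hb
        have h4 := sub_eq_zero.1 ((pow_eq_zero_iff (by simp [hbi, hN])).1 hb)
        exact hbi (Subtype.ext ((starRingEnd ℂ).injective h4).symm)
  · intro i hi hii
    rw [Polynomial.eval_mul, hT, Polynomial.eval_prod]
    refine mul_eq_zero_of_right _ (Finset.prod_eq_zero (Finset.mem_image_of_mem Prod.fst hi₀) ?_)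
    have h5 : (N - if i₀.1 = i.1 then i.2 + 1 else 0) ≠ 0 := by
      split_ifs with h
      · have := hle i hi
        have : i.2 ≠ i₀.2 := fun h' => hii (Prod.ext h.symm h')
        omega
      · omega
    simp [h5]
  · exact fun h => absurd hi₀ h

theorem linearIndependent_kernelMonomial (n : ℕ) :
    LinearIndependent ℂ fun i : tube n × (Fin n → ℕ) =>
      (tube n).domRestrict (kernelMonomial i.2 i.1.1) := by
  refine LinearIndependent.of_comp (LinearMap.funLeft ℂ ℂ
    fun x : Fin n → {x : ℂ // 0 < x.im} => (⟨fun k => (x k).1, fun k => (x k).2⟩ : tube n)) ?_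
  have h := (linearIndependent_prod_apply linearIndependent_inv_pow n).comp
    (fun (i : tube n × (Fin n → ℕ)) k => ((⟨i.1.1 k, i.1.2 k⟩ : {a : ℂ // 0 < a.im}), i.2 k))
    (fun i j h => by
      have h1 : ∀ k, i.1.1 k = j.1.1 k ∧ i.2 k = j.2 k := fun k => by
        simpa using congrFun h k
      exact Prod.ext (Subtype.ext (funext fun k => (h1 k).1)) (funext fun k => (h1 k).2))
  exact h

/-- The span of the kernel monomials at the point `p`, as functions on the tube. -/
noncomputable def kernelSpanAt {n : ℕ} (p : tube n) : Submodule ℂ (tube n → ℂ) :=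
  Submodule.span ℂ (Set.range fun α => (tube n).domRestrict (kernelMonomial α p.1))

/-- Joint independence over pairs (point, exponent) separates distinct points, so only repetitions
of one point need the hypothesis on the choice rule. -/
theorem iSupIndep_kernelSpanAt (n : ℕ) : iSupIndep (kernelSpanAt (n := n)) := by
  rw [iSupIndep_def]
  intro p
  have h := (linearIndependent_kernelMonomial n).disjoint_span_image
    (s := {i | i.1 = p}) (t := {i | i.1 ≠ p}) (Set.disjoint_left.2 fun i h1 h2 => h2 h1)
  refine h.mono (Submodule.span_mono ?_) (iSup₂_le fun q hq => Submodule.span_mono ?_)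
  · rintro _ ⟨α, rfl⟩
    exact ⟨(p, α), rfl, rfl⟩
  · rintro _ ⟨α, rfl⟩
    exact ⟨(q, α), hq, rfl⟩

theorem domRestrict_mem_kernelSpanAt {n h : ℕ} {Ψ : (Fin n → ℂ) → (Fin n → ℂ) → ℂ}
    (hΨ : Ψ ∈ kernelDerivatives n h) (p : tube n) : (tube n).domRestrict (Ψ p.1) ∈ kernelSpanAt p := by
  obtain ⟨G, hG, hGe⟩ := exists_mem_span_of_mem_kernelDerivatives hΨ
  have h1 : (tube n).domRestrict (Ψ p.1) = (tube n).domRestrict (G p.1) :=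
    funext fun w => hGe p.1 p.2 w.1 w.2
  rw [h1]
  clear h1 hGe
  induction hG using Submodule.span_induction with
  | mem G h =>
    obtain ⟨α, rfl⟩ := h
    exact Submodule.subset_span ⟨α, rfl⟩
  | zero => exact Submodule.zero_mem _
  | add G₁ G₂ _ _ h₁ h₂ => exact Submodule.add_mem _ h₁ h₂
  | smul c G _ h => exact Submodule.smul_mem _ c h

theorem memHardy_of_mem_kernelDerivatives {n h : ℕ} {Ψ : (Fin n → ℂ) → (Fin n → ℂ) → ℂ}
    (hΨ : Ψ ∈ kernelDerivatives n h) {p : Fin n → ℂ} (hp : p ∈ tube n) : MemHardy (Ψ p) := by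
  obtain ⟨G, hG, hGe⟩ := exists_mem_span_of_mem_kernelDerivatives hΨ
  refine MemHardy.congr (F := G p) ?_ fun w hw => hGe p hp w hw
  clear hGe
  induction hG using Submodule.span_induction with
  | mem G h =>
    obtain ⟨α, rfl⟩ := h
    exact memHardy_kernelMonomial α hp
  | zero => exact (hardySpace n).zero_mem
  | add G₁ G₂ _ _ h₁ h₂ => exact (hardySpace n).add_mem h₁ h₂
  | smul c G _ h => exact (hardySpace n).smul_mem c h

theorem IsKernelChoice.memHardy {n : ℕ} {Φ : (ℕ → Fin n → ℂ) → ℕ → (Fin n → ℂ) → ℂ}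
    (hΦ : IsKernelChoice Φ) {p : ℕ → Fin n → ℂ} (hp : ∀ j, p j ∈ tube n) (k : ℕ) :
    MemHardy (Φ p k) := by
  obtain ⟨h, _, _, Ψ, hΨ, he⟩ := hΦ.order p hp k
  rw [he]
  exact memHardy_of_mem_kernelDerivatives hΨ (hp k)

/-- Kernel elements attached to finitely many indices are linearly independent. -/
theorem IsKernelChoice.linearIndependent {n : ℕ} {Φ : (ℕ → Fin n → ℂ) → ℕ → (Fin n → ℂ) → ℂ}
    (hΦ : IsKernelChoice Φ) {p : ℕ → Fin n → ℂ} (hp : ∀ j, p j ∈ tube n) :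
    LinearIndependent ℂ fun j => (tube n).domRestrict (Φ p j) := by
  classical
  rw [linearIndependent_iff']
  intro s c hsum j₀ hj₀
  set q : ℕ → tube n := fun j => ⟨p j, hp j⟩ with hq
  have hgroup : ∀ a ∈ s.image q, ∑ j ∈ s with q j = a, c j • (tube n).domRestrict (Φ p j) = 0 := by
    refine (iSupIndep_iff_finsetSum_eq_zero_imp_eq_zero _).1 (iSupIndep_kernelSpanAt n) (s.image q)
      _ (fun a _ => Submodule.sum_mem _ fun j hj => Submodule.smul_mem _ _ ?_) ?_
    · obtain ⟨h, _, _, Ψ, hΨ, he⟩ := hΦ.order p hp j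
      rw [he, ← (Finset.mem_filter.1 hj).2]
      exact domRestrict_mem_kernelSpanAt hΨ (q j)
    · rw [Finset.sum_fiberwise_of_maps_to fun j hj => Finset.mem_image_of_mem q hj]
      exact hsum
  have h0 := hgroup _ (Finset.mem_image_of_mem q hj₀)
  -- `indep` concerns the repetitions up to a given index; the last index of the group in `s` makes
  -- it cover the whole group.
  obtain ⟨k, hk, hkmax⟩ := (s.filter fun j => q j = q j₀).exists_max_image id
    ⟨j₀, Finset.mem_filter.2 ⟨hj₀, rfl⟩⟩
  have hkq : q k = q j₀ := (Finset.mem_filter.1 hk).2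
  have hpq : ∀ j, p j = p k ↔ q j = q j₀ := fun j => by
    rw [← hkq]
    exact (Subtype.ext_iff (a1 := q j) (a2 := q k)).symm
  have hfil : (s.filter fun j => j ≤ k ∧ p j = p k) = s.filter fun j => q j = q j₀ := by
    refine Finset.filter_congr fun j hj => ?_
    rw [hpq]
    exact ⟨fun h => h.2, fun h => ⟨hkmax j (Finset.mem_filter.2 ⟨hj, h⟩), h⟩⟩
  have hli := linearIndependent_iff'.1 (hΦ.indep p hp k) (s.subtype fun j => j ≤ k ∧ p j = p k)
    (fun j => c j.1) (by
      rw [Finset.sum_subtype_eq_sum_filter (f := fun j => c j • (tube n).domRestrict (Φ p j)), hfil]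
      exact h0)
  have hj₁ : j₀ ≤ k ∧ p j₀ = p k := (Finset.mem_filter.1 (hfil ▸ Finset.mem_filter.2 ⟨hj₀, rfl⟩ :
    j₀ ∈ s.filter fun j => j ≤ k ∧ p j = p k)).2
  exact hli ⟨j₀, hj₁⟩ (Finset.mem_subtype.2 hj₀)

/-! ### Orthogonal projection through the Gram matrix -/

section Projection

variable {E : Type*} [NormedAddCommGroup E] [InnerProductSpace ℂ E]

/-- The projection onto the span of `v` written with the inverse of the Gram matrix. -/
noncomputable def gramProjection {m : ℕ} (v : Fin m → E) (f : E) : E :=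
  ∑ j, ∑ k, (inner ℂ (v j) f * conj ((Matrix.gram ℂ v)⁻¹ j k)) • v k

theorem gramProjection_mem_span {m : ℕ} (v : Fin m → E) (f : E) :
    gramProjection v f ∈ Submodule.span ℂ (Set.range v) :=
  Submodule.sum_mem _ fun _ _ => Submodule.sum_mem _ fun k _ =>
    Submodule.smul_mem _ _ (Submodule.subset_span ⟨k, rfl⟩)

theorem inner_sub_gramProjection {m : ℕ} {v : Fin m → E} (hv : IsUnit (Matrix.gram ℂ v).det)
    (f : E) (l : Fin m) : inner ℂ (v l) (f - gramProjection v f) = 0 := by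
  rw [inner_sub_right, sub_eq_zero, gramProjection]
  simp only [inner_sum, inner_smul_right]
  -- The conjugate of $A^{-1}A=1$; conjugation exchanges the arguments of the inner product, which
  -- is why $\overline{A^{-1}}$ occurs in the projection.
  have h1 : ∀ j, ∑ k, conj ((Matrix.gram ℂ v)⁻¹ j k) * inner ℂ (v l) (v k) = if j = l then 1 else 0 := by
    intro j
    have h2 := congrFun (congrFun (Matrix.nonsing_inv_mul _ hv) j) l
    rw [Matrix.mul_apply, Matrix.one_apply] at h2
    have h3 := congrArg conj h2
    rw [map_sum] at h3
    simp only [map_mul, Matrix.gram_apply, inner_conj_symm] at h3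
    rw [h3]
    split_ifs <;> simp
  simp only [mul_assoc, ← Finset.mul_sum, h1]
  simp

theorem inner_sub_gramProjection_of_mem_span {m : ℕ} {v : Fin m → E}
    (hv : IsUnit (Matrix.gram ℂ v).det) (f : E) {g : E} (hg : g ∈ Submodule.span ℂ (Set.range v)) :
    inner ℂ g (f - gramProjection v f) = 0 := by
  induction hg using Submodule.span_induction with
  | mem g h =>
    obtain ⟨l, rfl⟩ := h
    exact inner_sub_gramProjection hv f l
  | zero => exact inner_zero_left _
  | add g₁ g₂ _ _ h₁ h₂ => rw [inner_add_left, h₁, h₂, add_zero]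
  | smul c g _ h => rw [inner_smul_left, h, mul_zero]

theorem norm_sub_sq_gramProjection {m : ℕ} {v : Fin m → E} (hv : IsUnit (Matrix.gram ℂ v).det)
    (f : E) {g : E} (hg : g ∈ Submodule.span ℂ (Set.range v)) :
    ‖f - g‖ ^ 2 = ‖f - gramProjection v f‖ ^ 2 + ‖gramProjection v f - g‖ ^ 2 := by
  have h := inner_sub_gramProjection_of_mem_span hv f
    (Submodule.sub_mem _ (gramProjection_mem_span v f) hg)
  have h' : inner ℂ (f - gramProjection v f) (gramProjection v f - g) = 0 := by
    rw [← inner_conj_symm, h, map_zero]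
  have h2 := norm_add_sq (𝕜 := ℂ) (f - gramProjection v f) (gramProjection v f - g)
  rw [sub_add_sub_cancel, h'] at h2
  simpa using h2

/-- The squared distance from `r` to the line through `k` is $\|r\|^2-|\langle
k,r\rangle|^2/\|k\|^2$. In the application `s` is the squared norm of the next residual. -/
theorem norm_inner_sq_le_of_forall_le {r k : E} {s : ℝ} (h : ∀ c : ℂ, s ≤ ‖r - c • k‖ ^ 2) :
    ‖inner ℂ k r‖ ^ 2 ≤ ‖k‖ ^ 2 * (‖r‖ ^ 2 - s) := by
  by_cases hk : k = 0
  · simp [hk]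
  have hk' : 0 < ‖k‖ ^ 2 := by positivity
  have h1 := h (inner ℂ k r / (‖k‖ ^ 2 : ℝ))
  rw [norm_sub_sq (𝕜 := ℂ), inner_smul_right, ← inner_conj_symm r k, norm_smul, mul_pow,
    div_mul_eq_mul_div, RCLike.mul_conj, norm_div] at h1
  simp only [Complex.norm_real, norm_pow, norm_norm] at h1
  have h2 : RCLike.re (((‖inner ℂ k r‖ : ℂ) ^ 2) / ((‖k‖ ^ 2 : ℝ) : ℂ)) =
      ‖inner ℂ k r‖ ^ 2 / ‖k‖ ^ 2 := by
    rw [← Complex.ofReal_pow, ← Complex.ofReal_div]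
    exact Complex.ofReal_re _
  erw [h2] at h1
  have h3 : (‖inner ℂ k r‖ / ‖k‖ ^ 2) ^ 2 * ‖k‖ ^ 2 = ‖inner ℂ k r‖ ^ 2 / ‖k‖ ^ 2 := by
    field_simp
  rw [h3] at h1
  have h4 : ‖inner ℂ k r‖ ^ 2 / ‖k‖ ^ 2 ≤ ‖r‖ ^ 2 - s := by linarith
  rwa [div_le_iff₀' hk'] at h4

end Projection

/-! ### The greedy step and Fatou's lemma on slices -/

section KernelChoice

variable {n : ℕ} {Φ : (ℕ → Fin n → ℂ) → ℕ → (Fin n → ℂ) → ℂ}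

/-- The kernel elements attached to a sequence, as elements of the Hardy space. -/
def IsKernelChoice.element (hΦ : IsKernelChoice Φ) {p : ℕ → Fin n → ℂ} (hp : ∀ j, p j ∈ tube n)
    (j : ℕ) : hardySpace n := ⟨Φ p j, hΦ.memHardy hp j⟩

theorem IsKernelChoice.linearIndependent_boundaryValue (hΦ : IsKernelChoice Φ)
    {p : ℕ → Fin n → ℂ} (hp : ∀ j, p j ∈ tube n) :
    LinearIndependent ℂ fun j => boundaryValue n (hΦ.element hp j) := by
  rw [linearIndependent_iff']
  intro s c hc
  have h1 : boundaryValue n (∑ j ∈ s, c j • hΦ.element hp j) = 0 := by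
    simpa only [map_sum, map_smul] using hc
  refine linearIndependent_iff'.1 (hΦ.linearIndependent hp) s c (funext fun w => ?_)
  have h2 := eqOn_zero_of_boundaryValue_eq_zero _ h1 w.2
  simp only [Submodule.coe_sum, Submodule.coe_smul, Finset.sum_apply, Pi.smul_apply] at h2 ⊢
  exact h2

theorem IsKernelChoice.gramMatrix_eq (hΦ : IsKernelChoice Φ) {p : ℕ → Fin n → ℂ}
    (hp : ∀ j, p j ∈ tube n) (m : ℕ) : gramMatrix (Φ p) m =
      Matrix.gram ℂ fun j : Fin m => boundaryValue n (hΦ.element hp j) := by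
  ext j k
  exact hardyInner_eq_inner (hΦ.element hp k) (hΦ.element hp j)

theorem IsKernelChoice.isUnit_det_gram (hΦ : IsKernelChoice Φ) {p : ℕ → Fin n → ℂ}
    (hp : ∀ j, p j ∈ tube n) (m : ℕ) : IsUnit
      (Matrix.gram ℂ fun j : Fin m => boundaryValue n (hΦ.element hp j)).det := by
  have h := (hΦ.linearIndependent_boundaryValue hp).comp (fun j : Fin m => (j : ℕ))
    Fin.val_injective
  exact isUnit_iff_ne_zero.2 (Matrix.det_gram_ne_zero_iff_linearIndependent.2 h)

theorem IsKernelChoice.exists_afdApprox (hΦ : IsKernelChoice Φ) (F : hardySpace n)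
    {p : ℕ → Fin n → ℂ} (hp : ∀ j, p j ∈ tube n) (m : ℕ) :
    ∃ G : hardySpace n, (G : (Fin n → ℂ) → ℂ) = afdApprox F (Φ p) m ∧ boundaryValue n G =
      gramProjection (fun j : Fin m => boundaryValue n (hΦ.element hp j)) (boundaryValue n F) := by
  refine ⟨∑ j : Fin m, ∑ k : Fin m, (hardyInner (F : (Fin n → ℂ) → ℂ) (Φ p j) *
    conj ((gramMatrix (Φ p) m)⁻¹ j k)) • hΦ.element hp k, ?_, ?_⟩
  · ext w
    simp only [Submodule.coe_sum, Submodule.coe_smul, Finset.sum_apply, Pi.smul_apply, smul_eq_mul,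
      afdApprox]
    rfl
  · simp only [map_sum, map_smul, gramProjection, hΦ.gramMatrix_eq hp]
    refine Finset.sum_congr rfl fun j _ => Finset.sum_congr rfl fun k _ => ?_
    rw [← hardyInner_eq_inner F (hΦ.element hp j)]
    rfl

theorem IsKernelChoice.eq_szegoKernel (hΦ : IsKernelChoice Φ) {p : ℕ → Fin n → ℂ}
    (hp : ∀ j, p j ∈ tube n) {m : ℕ} (hm : ∀ j < m, p j ≠ p m) :
    Φ p m = fun w => szegoKernel w (p m) := by
  classical
  obtain ⟨h, h1, _, Ψ, hΨ, he⟩ := hΦ.order p hp m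
  have hocc : occurrences p m = 1 := by
    rw [occurrences, Finset.card_eq_one]
    refine ⟨m, ?_⟩
    ext j
    simp only [Finset.mem_filter, Finset.mem_range, Finset.mem_singleton]
    constructor
    · rintro ⟨hj, hjm⟩
      by_contra hne
      exact hm j (by omega) hjm
    · rintro rfl
      exact ⟨by omega, rfl⟩
  -- A first occurrence gives $\binom{h+n-1}{n}<1$, that is $h+n-1<n$, which forces order 0.
  rw [hocc, Nat.lt_one_iff, Nat.choose_eq_zero_iff] at h1
  obtain rfl : h = 0 := by omega
  rw [kernelDerivatives, Set.mem_singleton_iff] at hΨ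
  rw [he, hΨ]

/-- The residual of the greedy approximation is controlled at a new point by the decrease of its
norm. -/
theorem norm_residual_sq_le (hΦ : IsKernelChoice Φ) (F : hardySpace n)
    {z : ℕ → Fin n → ℂ} (hz : IsGreedy F Φ z) (R : ℕ → hardySpace n)
    (hR : ∀ m, (R m : (Fin n → ℂ) → ℂ) = F - afdApprox F (Φ z) m)
    (hb : ∀ m, boundaryValue n (R m) = boundaryValue n F - gramProjection
      (fun j : Fin m => boundaryValue n (hΦ.element (fun j => (hz j).1) j)) (boundaryValue n F))
    {w : Fin n → ℂ} (hw : w ∈ tube n) (hwz : ∀ j, z j ≠ w) (m : ℕ) :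
    ‖(R m).1 w‖ ^ 2 ≤ ‖boundaryValue n ⟨fun u => szegoKernel u w, memHardy_szegoKernel hw⟩‖ ^ 2 *
      (‖boundaryValue n (R m)‖ ^ 2 - ‖boundaryValue n (R (m + 1))‖ ^ 2) := by
  have hzt : ∀ j, z j ∈ tube n := fun j => (hz j).1
  set k := boundaryValue n ⟨fun u => szegoKernel u w, memHardy_szegoKernel hw⟩ with hk
  -- In the competing sequence the first `m` elements are unchanged by causality, and the element of
  -- index `m` is the kernel at `w`, because `w` is new.
  set p := Function.update z m w with hp
  have hpt : ∀ j, p j ∈ tube n := by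
    intro j
    rcases eq_or_ne j m with rfl | h
    · simpa [hp] using hw
    · simpa [hp, h] using hzt j
  have hpm : p m = w := by simp [hp]
  have hlow : ∀ j < m, hΦ.element hpt j = hΦ.element hzt j := by
    intro j hj
    refine Subtype.ext (hΦ.causal p z j fun i hi => ?_)
    simp [hp, (show i ≠ m by omega)]
  have htop : boundaryValue n (hΦ.element hpt m) = k := by
    rw [hk]
    congr 1
    refine Subtype.ext ?_
    have h1 := hΦ.eq_szegoKernel hpt (m := m) fun j hj => by
      rw [hpm]
      simpa [hp, hj.ne] using hwz j
    rw [hpm] at h1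
    exact h1
  obtain ⟨G, hG, hGb⟩ := hΦ.exists_afdApprox F hpt (m + 1)
  rw [← inner_boundaryValue_szegoKernel (R m) hw]
  refine norm_inner_sq_le_of_forall_le fun c => ?_
  set v : Fin (m + 1) → Lp ℂ 2 (volume : Measure (Fin n → ℝ)) :=
    fun j => boundaryValue n (hΦ.element hpt j) with hv
  have hgreedy : ‖boundaryValue n (R (m + 1))‖ ^ 2 ≤
      ‖boundaryValue n F - gramProjection v (boundaryValue n F)‖ ^ 2 := by
    have h1 := (hz m).2 w hw
    rw [← hR, ← hp, ← hG] at h1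
    have h2 : (F : (Fin n → ℂ) → ℂ) - G = ((F - G : hardySpace n) : (Fin n → ℂ) → ℂ) := rfl
    rw [h2, hardyNormSq_eq_enorm_sq, hardyNormSq_eq_enorm_sq, map_sub, hGb] at h1
    have h3 := ENNReal.toReal_mono (by simp) h1
    simpa using h3
  -- The old projection plus `c • k` lies in the competing span, so the competing residual, and by
  -- minimality the greedy one, is no longer than `R m - c • k`.
  have hmem : gramProjection (fun j : Fin m => boundaryValue n (hΦ.element hzt j))
      (boundaryValue n F) + c • k ∈ Submodule.span ℂ (Set.range v) := by
    refine Submodule.add_mem _ (Submodule.span_mono ?_ (gramProjection_mem_span _ _))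
      (Submodule.smul_mem _ _ (Submodule.subset_span ⟨Fin.last m, htop⟩))
    rintro _ ⟨j, rfl⟩
    refine ⟨j.castSucc, ?_⟩
    simp only [hv, Fin.val_castSucc, hlow j j.2]
  have h4 := norm_sub_sq_gramProjection (hΦ.isUnit_det_gram hpt (m + 1)) (boundaryValue n F) hmem
  rw [hb m, sub_sub, h4]
  exact hgreedy.trans (le_add_of_nonneg_right (sq_nonneg _))

theorem tubePoint_left_injective (y : Fin n → ℝ) : Function.Injective fun x => tubePoint x y := by
  intro x x' h
  ext k
  simpa [tubePoint] using congrFun h k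

/-- Fatou on each slice: $R_m-R_k\to R_m$ pointwise outside a countable set, which is null in
$\mathbb R^n$ because $n\ge1$. -/
theorem hardyNormSq_le_of_tendsto (hn : 1 ≤ n) (R : ℕ → hardySpace n) {S : Set (Fin n → ℂ)}
    (hS : S.Countable) (hlim : ∀ w ∈ tube n, w ∉ S → Tendsto (fun k => (R k).1 w) atTop (𝓝 0))
    {m : ℕ} {c : ℝ} (hc : ∀ᶠ k in atTop, ‖boundaryValue n (R m - R k)‖ ^ 2 ≤ c) :
    hardyNormSq (R m : (Fin n → ℂ) → ℂ) ≤ ENNReal.ofReal c := by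
  have : Nonempty (Fin n) := ⟨⟨0, hn⟩⟩
  refine iSup₂_le fun y hy => ?_
  have hnull : ∀ᵐ x : Fin n → ℝ, tubePoint x y ∉ S := by
    refine Set.Countable.measure_zero (s := {x | ¬ tubePoint x y ∉ S}) ?_ _
    simp only [not_not]
    exact hS.preimage (tubePoint_left_injective y)
  calc ∫⁻ x, ‖(R m).1 (tubePoint x y)‖ₑ ^ 2
      ≤ ∫⁻ x, liminf (fun k => ‖(R m - R k : hardySpace n).1 (tubePoint x y)‖ₑ ^ 2) atTop := by
        refine lintegral_mono_ae ?_
        filter_upwards [hnull] with x hx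
        have h1 : Tendsto (fun k => ‖(R m - R k : hardySpace n).1 (tubePoint x y)‖ₑ ^ 2) atTop
            (𝓝 (‖(R m).1 (tubePoint x y)‖ₑ ^ 2)) := by
          have h2 := (hlim _ (tubePoint_mem x hy) hx).const_sub ((R m).1 (tubePoint x y))
          rw [sub_zero] at h2
          exact ((ENNReal.continuous_pow 2).tendsto _).comp ((continuous_enorm.tendsto _).comp h2)
        exact h1.liminf_eq.ge
    _ ≤ liminf (fun k => ∫⁻ x, ‖(R m - R k : hardySpace n).1 (tubePoint x y)‖ₑ ^ 2) atTop :=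
        lintegral_liminf_le fun k =>
          (MemHardy.continuous_slice (R m - R k).2 hy).measurable.enorm.pow_const 2
    _ ≤ liminf (fun _ : ℕ => ENNReal.ofReal c) atTop := by
        refine liminf_le_liminf ?_
        filter_upwards [hc] with k hk
        refine (lintegral_slice_le _ hy).trans ?_
        rw [hardyNormSq_eq_enorm_sq, ← ofReal_norm, ← ENNReal.ofReal_pow (norm_nonneg _)]
        exact ENNReal.ofReal_le_ofReal hk
    _ = _ := liminf_const _

end KernelChoice

/-! ### Norm convergence -/

theorem theorem3p1 (n : ℕ) (hn : 1 ≤ n) (F : (Fin n → ℂ) → ℂ) (hF : MemHardy F)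
    (Φ : (ℕ → Fin n → ℂ) → ℕ → (Fin n → ℂ) → ℂ) (hΦ : IsKernelChoice Φ)
    (z : ℕ → Fin n → ℂ) (hz : IsGreedy F Φ z) :
    (∀ m, IsUnit (gramMatrix (Φ z) m).det) ∧
      (∀ m, MemHardy (afdApprox F (Φ z) m)) ∧
      Tendsto (fun m => hardyNorm (F - afdApprox F (Φ z) m)) atTop (𝓝 0) := by
  have hzt : ∀ j, z j ∈ tube n := fun j => (hz j).1
  choose G hG hGb using fun m => hΦ.exists_afdApprox ⟨F, hF⟩ hzt m
  refine ⟨fun m => by rw [hΦ.gramMatrix_eq hzt]; exact hΦ.isUnit_det_gram hzt m,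
    fun m => hG m ▸ (G m).2, ?_⟩
  set f := boundaryValue n ⟨F, hF⟩ with hf
  set v : ∀ m, Fin m → Lp ℂ 2 (volume : Measure (Fin n → ℝ)) :=
    fun m j => boundaryValue n (hΦ.element hzt j) with hv
  set R : ℕ → hardySpace n := fun m => ⟨F, hF⟩ - G m with hR
  have hRe : ∀ m, (R m : (Fin n → ℂ) → ℂ) = F - afdApprox F (Φ z) m := fun m => by
    rw [← hG m]; rfl
  have hRb : ∀ m, boundaryValue n (R m) = f - gramProjection (v m) f := fun m => by
    rw [hR, map_sub, hGb m]
  set a : ℕ → ℝ := fun m => ‖boundaryValue n (R m)‖ ^ 2 with ha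
  -- The spans are nested, so the earlier projection is a competitor in the later span.
  have hpyth : ∀ m k, m ≤ k → a m = a k + ‖boundaryValue n (R m - R k)‖ ^ 2 := by
    intro m k hmk
    have hmem : gramProjection (v m) f ∈ Submodule.span ℂ (Set.range (v k)) := by
      refine Submodule.span_mono ?_ (gramProjection_mem_span _ _)
      rintro _ ⟨j, rfl⟩
      exact ⟨Fin.castLE hmk j, rfl⟩
    have h1 := norm_sub_sq_gramProjection (hΦ.isUnit_det_gram hzt k) f hmem
    simp only [ha, map_sub, hRb, sub_sub_sub_cancel_left]
    exact h1
  have hanti : Antitone a := fun m k hmk => by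
    rw [hpyth m k hmk]
    exact le_add_of_nonneg_right (sq_nonneg _)
  obtain ⟨L, hL⟩ : ∃ L, Tendsto a atTop (𝓝 L) :=
    ⟨_, tendsto_atTop_ciInf hanti ⟨0, by rintro _ ⟨m, rfl⟩; exact sq_nonneg _⟩⟩
  -- Points of the sequence are excluded, since choosing one again would not add its kernel to the
  -- span.
  have hpoint : ∀ w ∈ tube n, w ∉ Set.range z → Tendsto (fun k => (R k).1 w) atTop (𝓝 0) := by
    intro w hw hwz
    have h1 := norm_residual_sq_le hΦ ⟨F, hF⟩ hz R hRe hRb hw fun j h => hwz ⟨j, h⟩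
    have h2 := (hL.sub (hL.comp (tendsto_add_atTop_nat 1))).const_mul
      (‖boundaryValue n ⟨fun u => szegoKernel u w, memHardy_szegoKernel hw⟩‖ ^ 2)
    rw [sub_self, mul_zero] at h2
    have h3 : Tendsto (fun k => ‖(R k).1 w‖ ^ 2) atTop (𝓝 0) :=
      squeeze_zero (fun _ => sq_nonneg _) h1 h2
    have h4 := (Real.continuous_sqrt.tendsto 0).comp h3
    rw [Real.sqrt_zero] at h4
    refine tendsto_zero_iff_norm_tendsto_zero.2 (h4.congr fun k => ?_)
    exact Real.sqrt_sq (norm_nonneg _)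
  have hbound : ∀ m, hardyNormSq (F - afdApprox F (Φ z) m) ≤ ENNReal.ofReal (a m - L) := by
    intro m
    rw [← hRe]
    refine hardyNormSq_le_of_tendsto hn R (Set.countable_range z) hpoint ?_
    filter_upwards [eventually_ge_atTop m] with k hk
    have h1 := hpyth m k hk
    have h2 := hanti.le_of_tendsto hL k
    linarith
  have hsq : Tendsto (fun m => hardyNormSq (F - afdApprox F (Φ z) m)) atTop (𝓝 0) := by
    refine tendsto_of_tendsto_of_tendsto_of_le_of_le tendsto_const_nhds ?_ (fun _ => zero_le) hbound
    have h1 := ENNReal.tendsto_ofReal (hL.sub_const L)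
    rwa [sub_self, ENNReal.ofReal_zero] at h1
  have h1 := ((ENNReal.continuous_rpow_const (y := 1 / 2)).tendsto 0).comp hsq
  rwa [ENNReal.zero_rpow_of_pos (by norm_num)] at h1
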